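/- **Setting.** Let $N\in\mathbb N$, $\eta\in\mathbb C$ with $q=e^{\eta}$ not a root of unity, $\xi_1,\dots,\xi_N\in\mathbb C$, and spins $s_n$ with $2s_n\in\mathbb N$. Put $[j]_q=\frac{\sinh(\eta j)}{\sinh\eta}$ and $x_n(k)=\sqrt{[k]_q[2s_n-k+1]_q}$ (principal root). On $V_n=\mathbb C^{2s_n+1}$ with basis $|k,n\rangle$, $0\le k\le 2s_n$, and dual basis $\langle k,n|$, let $$S_n^z|k,n\rangle=(s_n-k)|k,n\rangle,\quad S_n^-|k,n\rangle=x_n(k+1)|k+1,n\rangle,\quad S_n^+|k,n\rangle=x_n(k)|k-1,n\rangle .$$ On $\mathcal H=\otimes_{n=1}^N V_n$ define $$L_n(\lambda)=\begin{pmatrix}\sinh(\lambda+\eta S_n^z)&S_n^-\sinh\eta\\ S_n^+\sinh\eta&\sinh(\lambda-\eta S_n^z)\end{pmatrix},\qquad L_N(\lambda-\xi_N)\cdots L_1(\lambda-\xi_1)=\begin{pmatrix}A(\lambda)&B(\lambda)\\ C(\lambda)&D(\lambda)\end{pmatrix},$$ and, for $\kappa\in\mathbb C\setminus\{0\}$,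 the $\kappa$-twisted antiperiodic transfer matrix $\bar T^{(\kappa)}(\lambda)=\kappa^{-1}B(\lambda)+\kappa\,C(\lambda)$. An *eigenvalue function* of $\bar T^{(\kappa)}$ is a function $\bar t:\mathbb C\to\mathbb C$ such that some nonzero $v\in\mathcal H$ satisfies $\bar T^{(\kappa)}(\lambda)v=\bar t(\lambda)v$ for all $\lambda\in\mathbb C$. Let $$a(\lambda)=\prod_{n=1}^N\sinh(\lambda-\xi_n+s_n\eta),\qquad d(\lambda)=\prod_{n=1}^N\sinh(\lambda-\xi_n-s_n\eta),\qquad \xi_n^{(k)}=\xi_n+(s_n-k)\eta .$$ For $\bar t:\mathbb C\to\mathbb C$ let $D^{(n)}_{\bar t}$ be the tridiagonal $(2s_n+1)\times(2s_n+1)$ matrix, with rows and columns numbered $0,\dots,2s_n$, whose entries are $\bar t(\xi_n^{(i)})$ at $(i,i)$, $a(\xi_n^{(i)})$ at $(i,i+1)$ and $-d(\xi_n^{(i)})$ at $(i,i-1)$. Consider the conditions - (cond-inh): $\Xi_i\cap\Xi_j=\emptyset$ for $i\ne j$, where $\Xi_i=\{\xi_i+k\eta+ik'\pi : k=-s_i,-s_i+1,\dots,s_i;\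 k'\in\mathbb Z\}$ (the $i$ in front of $k'\pi$ is the imaginary unit); - (nodes): $\sinh(\xi_i-\xi_j)\ne0$ for $i\neq j$ (this follows from (cond-inh) if all the $2s_n$ have the same parity). Under these two conditions let $\mathsf n=\prod_{i<j}\sinh(\xi_j-\xi_i)^{1/2}$, $\langle\mathbf 0|=\frac1{\mathsf n}\otimes_n\langle0,n|$, $|\mathbf 0\rangle=\frac1{\mathsf n}\otimes_n|0,n\rangle$, and, for $\mathbf h=(h_1,\dots,h_N)$ with $h_n\in\{0,\dots,2s_n\}$, $$\langle\mathbf h|=\langle\mathbf 0|\prod_{n=1}^N\prod_{k=0}^{h_n-1}\frac{C(\xi_n^{(k)})}{d(\xi_n^{(k+1)})},\qquad |\mathbf h\rangle=\prod_{n=1}^N\prod_{k=0}^{h_n-1}\Bigl(-\frac{B(\xi_n^{(k)})}{a(\xi_n^{(k)})}\Bigr)|\mathbf 0\rangle ,$$ where the operators in the products are taken in increasing order of $n$, then of $k$, from left to right. **Theorem.** 1. For every $\kappa\ne0$: $[\bar T^{(\kappa)}(\lambda),\bar T^{(\kappa)}(\mu)]=0$ for all $\lambda,\mu\in\mathbb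 C$. 2. The set $\Sigma_{\bar T}$ of eigenvalue functions of $\bar T^{(\kappa)}$ is the same for all $\kappa\neq0$. 3. Assume (cond-inh). For every $\kappa\ne0$ the spectrum of $\bar T^{(\kappa)}$ is simple: for every $\bar t\in\Sigma_{\bar T}$ the joint eigenspaces $\{v:\bar T^{(\kappa)}(\lambda)v=\bar t(\lambda)v\ \forall\lambda\}$ and $\{w:w\,\bar T^{(\kappa)}(\lambda)=\bar t(\lambda)w\ \forall\lambda\}$ of vectors and of covectors are one-dimensional. Moreover, for every $n$, the right and left nullspaces of $D^{(n)}_{\bar t}$ are one-dimensional. 4. Assume (cond-inh) and (nodes). Then $\Sigma_{\bar T}$ is the set of all functions $\bar t$ of the form $$\bar t(\lambda)=\sum_{n=1}^N\ \prod_{\ell\neq n}\frac{\sinh(\lambda-\xi_\ell)}{\sinh(\xi_n-\xi_\ell)}\ \bar t(\xi_n)\qquad(\lambda\in\mathbb C)$$ such that $\det D^{(n)}_{\bar t}=0$ for all $n\in\{1,\dots,N\}$. Furthermore, let $\kappa\neq 0$ and $\bar t\in\Sigma_{\bar T}$, and for each $n$ let $\mathsf q^{(n)}=(\mathsf q^{(n)}_0,\dots,\mathsf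 q^{(n)}_{2s_n})$ and $\mathsf p^{(n)}=(\mathsf p^{(n)}_0,\dots,\mathsf p^{(n)}_{2s_n})$ be any nonzero vectors with $D^{(n)}_{\bar t}\mathsf q^{(n)}=0$ and ${}^t\mathsf p^{(n)}D^{(n)}_{\bar t}=0$. Then $$\langle\bar t^{(\kappa)}|=\sum_{\mathbf h}\prod_{n=1}^N\kappa^{h_n}\mathsf q^{(n)}_{h_n}\prod_{i<j}\sinh(\xi_j^{(h_j)}-\xi_i^{(h_i)})\,\langle\mathbf h|,\qquad |\bar t^{(\kappa)}\rangle=\sum_{\mathbf h}\prod_{n=1}^N\kappa^{-h_n}\mathsf p^{(n)}_{h_n}\prod_{i<j}\sinh(\xi_j^{(h_j)}-\xi_i^{(h_i)})\,|\mathbf h\rangle$$ are nonzero and satisfy, for all $\lambda\in\mathbb C$, $\langle\bar t^{(\kappa)}|\,\bar T^{(\kappa)}(\lambda)=\bar t(\lambda)\,\langle\bar t^{(\kappa)}|$ and $\bar T^{(\kappa)}(\lambda)\,|\bar t^{(\kappa)}\rangle=\bar t(\lambda)\,|\bar t^{(\kappa)}\rangle$. -/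

import Mathlib

noncomputable section

/-- The parameters of an inhomogeneous XXZ chain with `N` sites: `twoS n = 2 sₙ ∈ ℕ` is twice the
spin at site `n`, `η` is the crossing (anisotropy) parameter, so that `q = e^η`, and `ξ n` is the
inhomogeneity at site `n`. -/
structure SpinChain (N : ℕ) where
  twoS : Fin N → ℕ
  η : ℂ
  ξ : Fin N → ℂ

namespace SpinChain

variable {N : ℕ} (c : SpinChain N)

/-- `η` is not commensurate to `iπ`, i.e. `q = e^η` is not a root of unity. -/
def Generic : Prop := ∀ m : ℕ, 0 < m → Complex.exp c.η ^ m ≠ 1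

/-- The spin `sₙ`, as a complex number. -/
def spin (n : Fin N) : ℂ := (c.twoS n : ℂ) / 2

/-- The `N`-tuples `h = (h₁, …, h_N)` with `hₙ ∈ {0, …, 2 sₙ}`. They index the product basis
`⊗ₙ |hₙ, n⟩` of the space of states `⊗ₙ ℂ^(2 sₙ + 1)`. -/
abbrev Conf : Type := (n : Fin N) → Fin (c.twoS n + 1)

/-- The space of states, in coordinates with respect to the product basis `⊗ₙ |hₙ, n⟩`; row
vectors (the left space) are written in the coordinates of the dual product basis. -/
abbrev States : Type := c.Conf → ℂ

/-- Operators on the space of states, as matrices in the product basis. -/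
abbrev Op : Type := Matrix c.Conf c.Conf ℂ

/-- The `q`-integer `[j]_q = sinh (η j) / sinh η`. -/
def qInt (j : ℂ) : ℂ := Complex.sinh (c.η * j) / Complex.sinh c.η

/-- `xₙ(k) = √([k]_q [2 sₙ - k + 1]_q)` (principal branch of the square root). -/
def x (n : Fin N) (k : ℕ) : ℂ :=
  (c.qInt (k : ℂ) * c.qInt ((c.twoS n : ℂ) - (k : ℂ) + 1)) ^ (1 / 2 : ℂ)

/-- The local operator `S⁻` at site `n`: `S⁻ |k⟩ = x(k+1) |k+1⟩`. -/
def Sminus (n : Fin N) : Matrix (Fin (c.twoS n + 1)) (Fin (c.twoS n + 1)) ℂ :=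
  fun i j => if (i : ℕ) = (j : ℕ) + 1 then c.x n ((j : ℕ) + 1) else 0

/-- The local operator `S⁺` at site `n`: `S⁺ |k⟩ = x(k) |k-1⟩`. -/
def Splus (n : Fin N) : Matrix (Fin (c.twoS n + 1)) (Fin (c.twoS n + 1)) ℂ :=
  fun i j => if (j : ℕ) = (i : ℕ) + 1 then c.x n (j : ℕ) else 0

/-- The eigenvalue `sₙ - k` of `Sᶻ` on `|k, n⟩`. -/
def Sz (n : Fin N) (k : Fin (c.twoS n + 1)) : ℂ := c.spin n - ((k : ℕ) : ℂ)

/-- The local operator `X` acting at site `n`, and the identity at all the other sites. -/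
def siteOp (n : Fin N) (X : Matrix (Fin (c.twoS n + 1)) (Fin (c.twoS n + 1)) ℂ) : c.Op :=
  fun h g => if ∀ m, m ≠ n → h m = g m then X (h n) (g n) else 0

/-- The Lax operator at site `n`, a `2 × 2` matrix (auxiliary space) whose entries act on the space
of states. As `Sᶻ` is diagonal, so is `sinh (λ ± η Sᶻ)`. -/
def lax (n : Fin N) (l : ℂ) : Matrix (Fin 2) (Fin 2) c.Op :=
  !![c.siteOp n (Matrix.diagonal fun k => Complex.sinh (l + c.η * c.Sz n k)),
      Complex.sinh c.η • c.siteOp n (c.Sminus n);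
    Complex.sinh c.η • c.siteOp n (c.Splus n),
      c.siteOp n (Matrix.diagonal fun k => Complex.sinh (l - c.η * c.Sz n k))]

/-- The monodromy matrix `M(λ) = L_N(λ - ξ_N) ⋯ L₁(λ - ξ₁)`. -/
def monodromy (l : ℂ) : Matrix (Fin 2) (Fin 2) c.Op :=
  (List.ofFn fun n : Fin N => c.lax n (l - c.ξ n)).reverse.prod

/-- The entry `B(λ)` of the monodromy matrix. -/
def opB (l : ℂ) : c.Op := c.monodromy l 0 1

/-- The entry `C(λ)` of the monodromy matrix. -/
def opC (l : ℂ) : c.Op := c.monodromy l 1 0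

/-- The `κ`-twisted antiperiodic transfer matrix `κ⁻¹ B(λ) + κ C(λ)`. -/
def transfer (κ l : ℂ) : c.Op := κ⁻¹ • c.opB l + κ • c.opC l

/-- `Σ`, the set of eigenvalue functions of the family `λ ↦ T^(κ)(λ)`: the functions `t` such that
some nonzero vector `v` satisfies `T^(κ)(λ) v = t(λ) v` for all `λ`. -/
def eigenvalueFunctions (κ : ℂ) : Set (ℂ → ℂ) :=
  {t | ∃ v : c.States, v ≠ 0 ∧ ∀ l : ℂ, (c.transfer κ l).mulVec v = t l • v}

/-- The (right) joint eigenspace `{v | ∀ λ, T^(κ)(λ) v = t(λ) v}`. -/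
def rightEigenspace (κ : ℂ) (t : ℂ → ℂ) : Submodule ℂ c.States :=
  ⨅ l : ℂ, LinearMap.ker ((c.transfer κ l).mulVecLin - t l • LinearMap.id)

/-- The left joint eigenspace `{w | ∀ λ, w T^(κ)(λ) = t(λ) w}`. -/
def leftEigenspace (κ : ℂ) (t : ℂ → ℂ) : Submodule ℂ c.States :=
  ⨅ l : ℂ, LinearMap.ker ((c.transfer κ l).vecMulLinear - t l • LinearMap.id)

/-- `a(λ) = ∏ₙ sinh (λ - ξₙ + sₙ η)`. -/
def a (l : ℂ) : ℂ := ∏ n, Complex.sinh (l - c.ξ n + c.spin n * c.η)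

/-- `d(λ) = ∏ₙ sinh (λ - ξₙ - sₙ η)`. -/
def d (l : ℂ) : ℂ := ∏ n, Complex.sinh (l - c.ξ n - c.spin n * c.η)

/-- The shifted inhomogeneity `ξₙ^(k) = ξₙ + (sₙ - k) η`. -/
def ξs (n : Fin N) (k : ℕ) : ℂ := c.ξ n + (c.spin n - (k : ℂ)) * c.η

/-- `Ξₙ = {ξₙ + k η + i k' π | k = -sₙ, -sₙ + 1, …, sₙ, k' ∈ ℤ}`. -/
def Xi (n : Fin N) : Set ℂ :=
  {z | ∃ k : ℕ, k ≤ c.twoS n ∧ ∃ k' : ℤ,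
    z = c.ξ n + (-c.spin n + (k : ℂ)) * c.η + Complex.I * (k' : ℂ) * (Real.pi : ℂ)}

/-- The condition on the inhomogeneities: the sets `Ξₙ` are pairwise disjoint. -/
def CondInh : Prop := ∀ i j : Fin N, i ≠ j → c.Xi i ∩ c.Xi j = ∅

/-- The interpolation nodes `ξₙ` are pairwise distinct modulo `iπ`. -/
def DistinctNodes : Prop := ∀ i j : Fin N, i ≠ j → Complex.sinh (c.ξ i - c.ξ j) ≠ 0

/-- `t` is of the form
`t(λ) = ∑ₙ (∏_{ℓ ≠ n} sinh (λ - ξ_ℓ) / sinh (ξₙ - ξ_ℓ)) t(ξₙ)`. -/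
def IsInterpolation (t : ℂ → ℂ) : Prop :=
  ∀ l : ℂ, t l = ∑ n, (∏ m ∈ Finset.univ.erase n,
    Complex.sinh (l - c.ξ m) / Complex.sinh (c.ξ n - c.ξ m)) * t (c.ξ n)

/-- The tridiagonal matrix `D_t^(n)`: diagonal entries `t(ξₙ^(i))`, entries `a(ξₙ^(i))` right of the
diagonal and `-d(ξₙ^(i))` left of it, in row `i = 0, …, 2 sₙ`. -/
def Dmat (t : ℂ → ℂ) (n : Fin N) : Matrix (Fin (c.twoS n + 1)) (Fin (c.twoS n + 1)) ℂ :=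
  fun i j =>
    if (j : ℕ) = (i : ℕ) then t (c.ξs n i)
    else if (j : ℕ) = (i : ℕ) + 1 then c.a (c.ξs n i)
    else if (i : ℕ) = (j : ℕ) + 1 then -c.d (c.ξs n i)
    else 0

/-- The coordinates of both reference states: `1 / ∏_{i<j} sinh (ξⱼ - ξᵢ)^(1/2)` times the basis
vector (or covector) labelled by `(0, …, 0)`. -/
def refState : c.States :=
  (∏ j : Fin N, ∏ i ∈ Finset.Iio j, Complex.sinh (c.ξ j - c.ξ i) ^ (1 / 2 : ℂ))⁻¹ •
    Pi.single (fun _ => 0) 1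

/-- The operator `∏ₙ ∏_{k < hₙ} C(ξₙ^(k)) / d(ξₙ^(k+1))`; the factors are written in
increasing order of `n` and `k` (they commute). -/
def leftSOVOp (h : c.Conf) : c.Op :=
  (List.ofFn fun n : Fin N => (List.ofFn fun k : Fin (h n : ℕ) =>
    (c.d (c.ξs n ((k : ℕ) + 1)))⁻¹ • c.opC (c.ξs n (k : ℕ))).prod).prod

/-- The operator `∏ₙ ∏_{k < hₙ} (- B(ξₙ^(k)) / a(ξₙ^(k)))`; the factors are written in
increasing order of `n` and `k` (they commute). -/
def rightSOVOp (h : c.Conf) : c.Op :=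
  (List.ofFn fun n : Fin N => (List.ofFn fun k : Fin (h n : ℕ) =>
    -((c.a (c.ξs n (k : ℕ)))⁻¹ • c.opB (c.ξs n (k : ℕ)))).prod).prod

/-- The SOV covector `⟨h|`. -/
def bra (h : c.Conf) : c.States := Matrix.vecMul c.refState (c.leftSOVOp h)

/-- The SOV vector `|h⟩`. -/
def ket (h : c.Conf) : c.States := (c.rightSOVOp h).mulVec c.refState

/-- `∏_{i<j} sinh (ξⱼ^(hⱼ) - ξᵢ^(hᵢ))`. -/
def vdm (h : c.Conf) : ℂ :=
  ∏ j : Fin N, ∏ i ∈ Finset.Iio j, Complex.sinh (c.ξs j (h j) - c.ξs i (h i))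

/-- The covector `∑_h ∏ₙ κ^{hₙ} qₙ(hₙ) ∏_{i<j} sinh (ξⱼ^(hⱼ) - ξᵢ^(hᵢ)) ⟨h|`. -/
def leftEigenstate (κ : ℂ) (q : (n : Fin N) → Fin (c.twoS n + 1) → ℂ) : c.States :=
  ∑ h : c.Conf, ((∏ n, κ ^ (h n : ℕ) * q n (h n)) * c.vdm h) • c.bra h

/-- The vector `∑_h ∏ₙ κ^{-hₙ} pₙ(hₙ) ∏_{i<j} sinh (ξⱼ^(hⱼ) - ξᵢ^(hᵢ)) |h⟩`. -/
def rightEigenstate (κ : ℂ) (p : (n : Fin N) → Fin (c.twoS n + 1) → ℂ) : c.States :=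
  ∑ h : c.Conf, ((∏ n, κ⁻¹ ^ (h n : ℕ) * p n (h n)) * c.vdm h) • c.ket h

end SpinChain

end

/-! The algebra. Each Lax operator satisfies the Yang–Baxter relation with the six-vertex R-matrix
and has a central quantum determinant. Entries belonging to different sites commute, so both
properties pass to the monodromy matrix (`RTT.mul`, `HasQDet.mul`). The Yang–Baxter relation makes
the B's commute, the C's commute and B(λ)C(μ) + C(λ)B(μ) symmetric in λ and μ, which is the
commutativity of the transfer matrices. Conjugation by r^(h₁ + ⋯ + h_N) rescales B and C inversely,
hence moves one twist to any other without changing eigenvalues.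

Separation of variables. The operators D(λ) are simultaneously diagonalized. Starting from the
reference state, B(ξₙ^(k)) on vectors, or C(ξₙ^(k)) on covectors, raises hₙ by one and shifts one
zero of the eigenvalue ∏ₙ sinh(λ - ξₙ^(hₙ)): the unwanted term of the exchange relation is absent
because D(ξₙ^(hₙ)) kills the state. The quantum determinant shows that the raising step can be
undone, so no state vanishes; disjointness of the Ξₙ makes the eigenvalues distinct, so the states
form a basis (`IsSeparate.linearIndependent`). Raising above 2sₙ or lowering below 0 would produce
an eigenvector with a new eigenvalue, so it gives zero.

Spectrum. In this basis the transfer matrix at λ = ξₙ^(hₙ) changes only hₙ, by ±1, with the entries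
of D^(n) as coefficients. Its matrix elements are trigonometric polynomials determined by N values,
so its action at every λ follows by interpolation at nodes that depend on h. The factor ∏
sinh(ξⱼ^(hⱼ) - ξᵢ^(hᵢ)) exactly compensates this dependence (`vdm_mul_lagrange_update`), and
products of null vectors of the D^(n) give eigenstates (`apply_separateState`).

Conversely, an eigenvector paired with the separate states of the opposite side gives, in each
coordinate hₙ, a null vector of a tridiagonal matrix (`baxter_mulVec`). This forces det D^(n) = 0.
The entries next to the diagonal do not vanish, so a null vector is fixed by its entry 0, and
coordinate by coordinate the whole eigenvector is fixed by its pairing with the reference state: the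
spectrum is simple. -/

noncomputable section

/-! ### Quantum `2 × 2` matrices -/

namespace YangBaxter

variable {R : Type*} [Ring R]

/-- The six-vertex `R`-matrix, with entries in a `ℂ`-algebra. -/
def rMat (R : Type*) [Ring R] [Algebra ℂ R] (η u : ℂ) :
    Matrix (Fin 2 × Fin 2) (Fin 2 × Fin 2) R :=
  fun p q => if p = q then
      (if p.1 = p.2 then algebraMap ℂ R (Complex.sinh (u + η))
        else algebraMap ℂ R (Complex.sinh u))
    else if p.1 = q.2 ∧ p.2 = q.1 then algebraMap ℂ R (Complex.sinh η) else 0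

/-- `M ⊗ 1` -/
def inFst (M : Matrix (Fin 2) (Fin 2) R) : Matrix (Fin 2 × Fin 2) (Fin 2 × Fin 2) R :=
  fun p q => if p.2 = q.2 then M p.1 q.1 else 0

/-- `1 ⊗ M` -/
def inSnd (M : Matrix (Fin 2) (Fin 2) R) : Matrix (Fin 2 × Fin 2) (Fin 2 × Fin 2) R :=
  fun p q => if p.1 = q.1 then M p.2 q.2 else 0

theorem inFst_mul (L M : Matrix (Fin 2) (Fin 2) R) : inFst (L * M) = inFst L * inFst M := by
  ext ⟨i, j⟩ ⟨k, l⟩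
  simp only [inFst, Matrix.mul_apply, Fintype.sum_prod_type]
  by_cases h : j = l <;> simp [h]

theorem inSnd_mul (L M : Matrix (Fin 2) (Fin 2) R) : inSnd (L * M) = inSnd L * inSnd M := by
  ext ⟨i, j⟩ ⟨k, l⟩
  simp only [inSnd, Matrix.mul_apply, Fintype.sum_prod_type]
  by_cases h : i = k <;> simp [h]

theorem inFst_inSnd_apply (L M : Matrix (Fin 2) (Fin 2) R) (i j k l : Fin 2) :
    (inFst L * inSnd M) (i, j) (k, l) = L i k * M j l := by
  simp [inFst, inSnd, Matrix.mul_apply, Fintype.sum_prod_type]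

theorem inSnd_inFst_apply (L M : Matrix (Fin 2) (Fin 2) R) (i j k l : Fin 2) :
    (inSnd M * inFst L) (i, j) (k, l) = M j l * L i k := by
  simp [inFst, inSnd, Matrix.mul_apply, Fintype.sum_prod_type]

theorem inFst_inSnd_comm {L M : Matrix (Fin 2) (Fin 2) R}
    (h : ∀ i j k l, Commute (L i j) (M k l)) : inFst L * inSnd M = inSnd M * inFst L := by
  ext ⟨i, j⟩ ⟨k, l⟩
  rw [inFst_inSnd_apply, inSnd_inFst_apply, (h _ _ _ _).eq]

/-- The adjugate of a `2 × 2` matrix. -/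
def adj (M : Matrix (Fin 2) (Fin 2) R) : Matrix (Fin 2) (Fin 2) R :=
  !![M 1 1, -M 0 1; -M 1 0, M 0 0]

/-- Over a noncommutative ring the adjugate reverses products only because every entry of `L`
commutes with every entry of `M`; entries of one factor need not commute among themselves. -/
theorem adj_mul {L M : Matrix (Fin 2) (Fin 2) R} (h : ∀ i j k l, Commute (L i j) (M k l)) :
    adj (L * M) = adj M * adj L := by
  ext i j
  fin_cases i <;> fin_cases j <;>
    simp [adj, Matrix.mul_apply, Fin.sum_univ_two, (h _ _ _ _).eq] <;> abel

variable [Algebra ℂ R]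

/-- The Yang–Baxter relation `R₁₂(λ - μ) M₁(λ) M₂(μ) = M₂(μ) M₁(λ) R₁₂(λ - μ)`. -/
def RTT (η : ℂ) (M : ℂ → Matrix (Fin 2) (Fin 2) R) : Prop :=
  ∀ l m : ℂ, rMat R η (l - m) * (inFst (M l) * inSnd (M m)) =
    inSnd (M m) * inFst (M l) * rMat R η (l - m)

/-- M₁(λ) and L₂(μ) commute, so the product regroups as L₁L₂ followed by M₁M₂, and the R-matrix
passes through each pair in turn. -/
theorem RTT.mul {η : ℂ} {L M : ℂ → Matrix (Fin 2) (Fin 2) R} (hL : RTT η L) (hM : RTT η M)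
    (h : ∀ l m i j k n, Commute (L l i j) (M m k n)) : RTT η (fun l => L l * M l) := by
  intro l m
  have h1 : inFst (M l) * inSnd (L m) = inSnd (L m) * inFst (M l) :=
    inFst_inSnd_comm fun i j k n => (h _ _ _ _ _ _).symm
  have h2 : inFst (L l) * inSnd (M m) = inSnd (M m) * inFst (L l) :=
    inFst_inSnd_comm fun i j k n => h _ _ _ _ _ _
  have e1 := hL l m
  have e2 := hM l m
  simp only [inFst_mul, inSnd_mul]
  calc rMat R η (l - m) * (inFst (L l) * inFst (M l) * (inSnd (L m) * inSnd (M m)))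
      = rMat R η (l - m) * (inFst (L l) * (inFst (M l) * inSnd (L m)) * inSnd (M m)) := by
        simp only [mul_assoc]
    _ = rMat R η (l - m) * (inFst (L l) * inSnd (L m)) * (inFst (M l) * inSnd (M m)) := by
        rw [h1]; simp only [mul_assoc]
    _ = inSnd (L m) * inFst (L l) * (rMat R η (l - m) * (inFst (M l) * inSnd (M m))) := by
        rw [e1]; simp only [mul_assoc]
    _ = inSnd (L m) * (inFst (L l) * inSnd (M m)) * inFst (M l) * rMat R η (l - m) := by
        rw [e2]; simp only [mul_assoc]
    _ = _ := by rw [h2]; simp only [mul_assoc]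

theorem RTT_one (η : ℂ) : RTT η (fun _ => (1 : Matrix (Fin 2) (Fin 2) R)) := by
  intro l m
  have h1 : inFst (1 : Matrix (Fin 2) (Fin 2) R) = 1 := by
    ext ⟨i, j⟩ ⟨k, n⟩
    simp only [inFst, Matrix.one_apply, Prod.mk.injEq]
    split_ifs <;> simp_all
  have h2 : inSnd (1 : Matrix (Fin 2) (Fin 2) R) = 1 := by
    ext ⟨i, j⟩ ⟨k, n⟩
    simp only [inSnd, Matrix.one_apply, Prod.mk.injEq]
    split_ifs <;> simp_all
  simp [h1, h2]

/-- The Yang–Baxter relation, entry by entry. -/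
theorem RTT_iff {η : ℂ} {M : ℂ → Matrix (Fin 2) (Fin 2) R} : RTT η M ↔
    ∀ l m : ℂ, ∀ p q : Fin 2 × Fin 2,
      ∑ r : Fin 2 × Fin 2, rMat R η (l - m) p r * (M l r.1 q.1 * M m r.2 q.2) =
      ∑ r : Fin 2 × Fin 2, M m p.2 r.2 * M l p.1 r.1 * rMat R η (l - m) r q := by
  unfold RTT
  refine forall_congr' fun l => forall_congr' fun m => ?_
  rw [← Matrix.ext_iff]
  refine forall_congr' fun p => forall_congr' fun q => ?_
  rw [Matrix.mul_apply (M := rMat R η (l - m)), Matrix.mul_apply (N := rMat R η (l - m))]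
  obtain ⟨i, j⟩ := p
  obtain ⟨k, n⟩ := q
  simp only [Fintype.sum_prod_type, inFst_inSnd_apply, inSnd_inFst_apply]

/-! ### Exchange relations between the entries A, B, C, D -/

section Exchange

variable {η : ℂ} {M : ℂ → Matrix (Fin 2) (Fin 2) R}

theorem RTT.B_B (h : RTT η M) (l m : ℂ) :
    Complex.sinh (l - m + η) • (M l 0 1 * M m 0 1) =
      Complex.sinh (l - m + η) • (M m 0 1 * M l 0 1) := by
  have := RTT_iff.1 h l m (0, 0) (1, 1)
  simpa [Fintype.sum_prod_type, rMat, Algebra.smul_def, Algebra.commutes] using this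

theorem RTT.C_C (h : RTT η M) (l m : ℂ) :
    Complex.sinh (l - m + η) • (M l 1 0 * M m 1 0) =
      Complex.sinh (l - m + η) • (M m 1 0 * M l 1 0) := by
  have := RTT_iff.1 h l m (1, 1) (0, 0)
  simpa [Fintype.sum_prod_type, rMat, Algebra.smul_def, Algebra.commutes] using this

theorem RTT.B_C (h : RTT η M) (l m : ℂ) :
    Complex.sinh (l - m) • (M l 0 1 * M m 1 0) + Complex.sinh η • (M l 1 1 * M m 0 0) =
      Complex.sinh η • (M m 1 1 * M l 0 0) + Complex.sinh (l - m) • (M m 1 0 * M l 0 1) := by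
  have := RTT_iff.1 h l m (0, 1) (1, 0)
  simpa [Fintype.sum_prod_type, rMat, Algebra.smul_def, Algebra.commutes] using this

theorem RTT.D_B (h : RTT η M) (l m : ℂ) :
    Complex.sinh η • (M l 0 1 * M m 1 1) + Complex.sinh (l - m) • (M l 1 1 * M m 0 1) =
      Complex.sinh (l - m + η) • (M m 0 1 * M l 1 1) := by
  have := RTT_iff.1 h l m (1, 0) (1, 1)
  simpa [Fintype.sum_prod_type, rMat, Algebra.smul_def, Algebra.commutes] using this

theorem RTT.B_D (h : RTT η M) (l m : ℂ) :
    Complex.sinh (l - m) • (M l 0 1 * M m 1 1) + Complex.sinh η • (M l 1 1 * M m 0 1) =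
      Complex.sinh (l - m + η) • (M m 1 1 * M l 0 1) := by
  have := RTT_iff.1 h l m (0, 1) (1, 1)
  simpa [Fintype.sum_prod_type, rMat, Algebra.smul_def, Algebra.commutes] using this

theorem RTT.D_C (h : RTT η M) (l m : ℂ) :
    Complex.sinh (l - m + η) • (M l 1 1 * M m 1 0) =
      Complex.sinh η • (M m 1 1 * M l 1 0) + Complex.sinh (l - m) • (M m 1 0 * M l 1 1) := by
  have := RTT_iff.1 h l m (1, 1) (1, 0)
  simpa [Fintype.sum_prod_type, rMat, Algebra.smul_def, Algebra.commutes] using this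

theorem RTT.C_D (h : RTT η M) (l m : ℂ) :
    Complex.sinh (l - m + η) • (M l 1 0 * M m 1 1) =
      Complex.sinh (l - m) • (M m 1 1 * M l 1 0) + Complex.sinh η • (M m 1 0 * M l 1 1) := by
  have := RTT_iff.1 h l m (1, 1) (0, 1)
  simpa [Fintype.sum_prod_type, rMat, Algebra.smul_def, Algebra.commutes] using this

end Exchange

/-- `M(λ)` has the central quantum determinant `q(λ)`. -/
def HasQDet (η : ℂ) (M : ℂ → Matrix (Fin 2) (Fin 2) R) (q : ℂ → ℂ) : Prop :=
  ∀ l : ℂ, M l * adj (M (l - η)) = q l • (1 : Matrix (Fin 2) (Fin 2) R) ∧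
    adj (M (l - η)) * M l = q l • (1 : Matrix (Fin 2) (Fin 2) R)

/-- Since `adj` reverses the product, the inner pair collapses to a scalar, which moves out and
leaves the outer pair. -/
theorem HasQDet.mul {η : ℂ} {L M : ℂ → Matrix (Fin 2) (Fin 2) R} {q r : ℂ → ℂ}
    (hL : HasQDet η L q) (hM : HasQDet η M r)
    (h : ∀ l m i j k n, Commute (L l i j) (M m k n)) :
    HasQDet η (fun l => L l * M l) (fun l => q l * r l) := by
  intro l
  simp only [adj_mul (fun i j k n => h (l - η) (l - η) i j k n)]
  constructor
  · calc L l * M l * (adj (M (l - η)) * adj (L (l - η)))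
        = L l * (M l * adj (M (l - η))) * adj (L (l - η)) := by simp only [mul_assoc]
      _ = _ := by
        rw [(hM l).1, mul_smul_comm, smul_mul_assoc, mul_one, (hL l).1, smul_smul, mul_comm]
  · calc adj (M (l - η)) * adj (L (l - η)) * (L l * M l)
        = adj (M (l - η)) * (adj (L (l - η)) * L l) * M l := by simp only [mul_assoc]
      _ = _ := by
        rw [(hL l).2, mul_smul_comm, smul_mul_assoc, mul_one, (hM l).2, smul_smul]

theorem HasQDet_one (η : ℂ) :
    HasQDet η (fun _ => (1 : Matrix (Fin 2) (Fin 2) R)) (fun _ => 1) := by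
  have : adj (1 : Matrix (Fin 2) (Fin 2) R) = 1 := by
    ext i j
    fin_cases i <;> fin_cases j <;> simp [adj]
  intro l
  simp [this]

/-- On a vector killed by D(λ) this makes C(λ - η)B(λ) a scalar. The next identity does the same for
C(λ)B(λ - η) acting on covectors. -/
theorem HasQDet.A_D {η : ℂ} {M : ℂ → Matrix (Fin 2) (Fin 2) R} {q : ℂ → ℂ} (h : HasQDet η M q)
    (l : ℂ) : M (l - η) 0 0 * M l 1 1 - M (l - η) 1 0 * M l 0 1 = q l • (1 : R) := by
  have := congrFun (congrFun (h l).2 1) 1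
  simp only [adj, Matrix.mul_apply, Fin.sum_univ_two] at this
  simpa [sub_eq_add_neg, add_comm] using this

theorem HasQDet.D_A {η : ℂ} {M : ℂ → Matrix (Fin 2) (Fin 2) R} {q : ℂ → ℂ} (h : HasQDet η M q)
    (l : ℂ) : M l 1 1 * M (l - η) 0 0 - M l 1 0 * M (l - η) 0 1 = q l • (1 : R) := by
  have := congrFun (congrFun (h l).1 1) 1
  simp only [adj, Matrix.mul_apply, Fin.sum_univ_two] at this
  simpa [sub_eq_add_neg, add_comm] using this

end YangBaxter

/-! ### Trigonometric polynomials -/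

namespace TrigPoly

open Polynomial

/-- `f` is a combination of `e^{(k - 1 - 2 j) λ}`, `0 ≤ j < k`. -/
def IsTrig (k : ℕ) (f : ℂ → ℂ) : Prop :=
  ∃ P : ℂ[X], P.degree < k ∧
    ∀ l : ℂ, Complex.exp (((k : ℂ) - 1) * l) * f l = P.eval (Complex.exp (2 * l))

theorem IsTrig.zero (k : ℕ) : IsTrig k (fun _ => 0) :=
  ⟨0, by simp, by simp⟩

theorem IsTrig.add {k : ℕ} {f g : ℂ → ℂ} (hf : IsTrig k f) (hg : IsTrig k g) :
    IsTrig k (fun l => f l + g l) := by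
  obtain ⟨P, hP, hP'⟩ := hf
  obtain ⟨Q, hQ, hQ'⟩ := hg
  refine ⟨P + Q, (degree_add_le _ _).trans_lt (max_lt hP hQ), fun l => ?_⟩
  rw [mul_add, hP', hQ', eval_add]

theorem IsTrig.const_mul {k : ℕ} {f : ℂ → ℂ} (hf : IsTrig k f) (a : ℂ) :
    IsTrig k (fun l => a * f l) := by
  obtain ⟨P, hP, hP'⟩ := hf
  refine ⟨a • P, (degree_smul_le _ _).trans_lt hP, fun l => ?_⟩
  rw [mul_left_comm, hP', eval_smul, smul_eq_mul]

theorem IsTrig.sum {ι : Type*} (s : Finset ι) {k : ℕ} {f : ι → ℂ → ℂ}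
    (hf : ∀ i ∈ s, IsTrig k (f i)) : IsTrig k (fun l => ∑ i ∈ s, f i l) := by
  classical
  induction s using Finset.induction_on with
  | empty => simpa using IsTrig.zero k
  | insert a s ha ih =>
    simp only [Finset.sum_insert ha]
    exact (hf _ (Finset.mem_insert_self _ _)).add
      (ih fun i hi => hf i (Finset.mem_insert_of_mem hi))

theorem IsTrig.mul {k m : ℕ} {f g : ℂ → ℂ} (hf : IsTrig (k + 1) f) (hg : IsTrig m g) :
    IsTrig (k + m) (fun l => f l * g l) := by
  obtain ⟨P, hP, hP'⟩ := hf
  obtain ⟨Q, hQ, hQ'⟩ := hg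
  refine ⟨P * Q, ?_, fun l => ?_⟩
  · rcases eq_or_ne P 0 with rfl | hP0
    · rw [zero_mul, degree_zero]
      exact WithBot.bot_lt_coe _
    rcases eq_or_ne Q 0 with rfl | hQ0
    · rw [mul_zero, degree_zero]
      exact WithBot.bot_lt_coe _
    rw [← natDegree_lt_iff_degree_lt (mul_ne_zero hP0 hQ0)]
    rw [← natDegree_lt_iff_degree_lt hP0] at hP
    rw [← natDegree_lt_iff_degree_lt hQ0] at hQ
    rw [natDegree_mul hP0 hQ0]
    omega
  · rw [eval_mul, ← hP', ← hQ']
    have : Complex.exp ((((k + m : ℕ) : ℂ) - 1) * l) =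
        Complex.exp ((((k + 1 : ℕ) : ℂ) - 1) * l) * Complex.exp (((m : ℂ) - 1) * l) := by
      rw [← Complex.exp_add]
      congr 1
      push_cast
      ring
    rw [this]
    ring

theorem IsTrig.const (a : ℂ) : IsTrig 1 (fun _ => a) :=
  ⟨C a, degree_C_le.trans_lt (by norm_num), by simp⟩

/-- The index fixes the parity of the exponents, so it can be raised only in steps of two. -/
theorem IsTrig.add_two {k : ℕ} {f : ℂ → ℂ} (hf : IsTrig k f) : IsTrig (k + 2) f := by
  obtain ⟨P, hP, hP'⟩ := hf
  refine ⟨X * P, ?_, fun l => ?_⟩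
  · rcases eq_or_ne P 0 with rfl | hP0
    · rw [mul_zero, degree_zero]
      exact WithBot.bot_lt_coe _
    rw [← natDegree_lt_iff_degree_lt (mul_ne_zero X_ne_zero hP0), natDegree_X_mul hP0]
    rw [← natDegree_lt_iff_degree_lt hP0] at hP
    omega
  · rw [eval_mul, eval_X, ← hP', ← mul_assoc, ← Complex.exp_add]
    congr 2
    push_cast
    ring

theorem IsTrig.sinh_sub (a : ℂ) : IsTrig 2 (fun l => Complex.sinh (l - a)) := by
  refine ⟨C (Complex.exp (-a) / 2) * X + C (-(Complex.exp a / 2)),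
    degree_linear_le.trans_lt (by norm_num), fun l => ?_⟩
  have h1 : Complex.exp (l - a) = Complex.exp l * Complex.exp (-a) := by
    rw [← Complex.exp_add, sub_eq_add_neg]
  have h2 : Complex.exp (-(l - a)) = Complex.exp (-l) * Complex.exp a := by
    rw [← Complex.exp_add]
    congr 1
    ring
  have h3 : Complex.exp (2 * l) = Complex.exp l * Complex.exp l := by
    rw [← Complex.exp_add, two_mul]
  have h4 : Complex.exp l * Complex.exp (-l) = 1 := by
    rw [← Complex.exp_add, add_neg_cancel, Complex.exp_zero]
  have h5 : (((2 : ℕ) : ℂ) - 1) * l = l := by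
    push_cast
    ring
  simp only [eval_add, eval_mul, eval_C, eval_X]
  rw [h5, Complex.sinh, h1, h2, h3]
  linear_combination (-(Complex.exp a / 2)) * h4

theorem IsTrig.prod_sinh_sub {ι : Type*} (s : Finset ι) (x : ι → ℂ) :
    IsTrig (s.card + 1) (fun l => ∏ i ∈ s, Complex.sinh (l - x i)) := by
  classical
  induction s using Finset.induction_on with
  | empty => simpa using IsTrig.const 1
  | insert a s ha ih =>
    simp only [Finset.prod_insert ha, Finset.card_insert_of_notMem ha]
    rw [show s.card + 1 + 1 = 1 + (s.card + 1) by ring]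
    exact (IsTrig.sinh_sub (x a)).mul ih

theorem IsTrig.continuous {k : ℕ} {f : ℂ → ℂ} (hf : IsTrig k f) : Continuous f := by
  obtain ⟨P, -, hP⟩ := hf
  have : f = fun l => Complex.exp (-(((k : ℂ) - 1) * l)) * P.eval (Complex.exp (2 * l)) := by
    funext l
    rw [← hP, ← mul_assoc, ← Complex.exp_add, neg_add_cancel, Complex.exp_zero, one_mul]
  rw [this]
  have := P.continuous
  fun_prop

theorem sinh_eq_zero_iff {z : ℂ} :
    Complex.sinh z = 0 ↔ ∃ n : ℤ, z = Complex.I * (n : ℂ) * (Real.pi : ℂ) := by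
  have h : Complex.sinh z = 0 ↔ Complex.exp (2 * z) = 1 := by
    have h1 : Complex.exp (2 * z) = Complex.exp z * Complex.exp z := by
      rw [← Complex.exp_add, two_mul]
    have h4 : Complex.exp z * Complex.exp (-z) = 1 := by
      rw [← Complex.exp_add, add_neg_cancel, Complex.exp_zero]
    rw [Complex.sinh, h1]
    constructor
    · intro h
      linear_combination (2 * Complex.exp z) * h + h4
    · intro h
      have : Complex.exp z * (Complex.exp z - Complex.exp (-z)) = 0 := by
        linear_combination h - h4
      rw [(mul_eq_zero.1 this).resolve_left (Complex.exp_ne_zero z), zero_div]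
  rw [h, Complex.exp_eq_one_iff]
  refine exists_congr fun n => ⟨fun h => ?_, fun h => ?_⟩
  · linear_combination h / 2
  · linear_combination 2 * h

theorem dense_sinh_sub_ne_zero (m : ℂ) : Dense {l : ℂ | Complex.sinh (l - m) ≠ 0} := by
  have : {l : ℂ | Complex.sinh (l - m) ≠ 0} =
      (Set.range fun n : ℤ => m + Complex.I * (n : ℂ) * (Real.pi : ℂ))ᶜ := by
    ext l
    simp only [Set.mem_ofPred_eq, ne_eq, Set.mem_compl_iff, Set.mem_range, sinh_eq_zero_iff]
    refine not_congr (exists_congr fun n => ⟨fun h => ?_, fun h => ?_⟩)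
    · linear_combination -h
    · linear_combination -h
  rw [this]
  exact (Set.countable_range _).dense_compl ℂ

/-- The factor vanishes only on a countable set, whose complement is dense. Continuity thus allows
sinh(λ - μ) to be cancelled from exchange relations even at its zeros. -/
theorem eq_of_sinh_smul_eq {E : Type*} [AddCommGroup E] [Module ℂ E] [TopologicalSpace E]
    [T2Space E] (m : ℂ) {f g : ℂ → E} (hf : Continuous f) (hg : Continuous g)
    (h : ∀ l, Complex.sinh (l - m) • f l = Complex.sinh (l - m) • g l) (l : ℂ) : f l = g l := by
  refine congrFun (Continuous.ext_on (dense_sinh_sub_ne_zero m) hf hg fun l hl => ?_) l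
  have := congrArg (fun v => (Complex.sinh (l - m))⁻¹ • v) (h l)
  simpa only [smul_smul, inv_mul_cancel₀ (show Complex.sinh (l - m) ≠ 0 from hl),
    one_smul] using this

theorem exp_two_mul_injective_of_sinh_ne {x y : ℂ} (h : Complex.sinh (x - y) ≠ 0) :
    Complex.exp (2 * x) ≠ Complex.exp (2 * y) := by
  intro he
  rw [Complex.exp_eq_exp_iff_exists_int] at he
  obtain ⟨n, hn⟩ := he
  exact h (sinh_eq_zero_iff.2 ⟨n, by linear_combination hn / 2⟩)

variable {N : ℕ}

/-- The Lagrange basis of trigonometric polynomials with respect to the nodes `x`. -/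
def lagrange (x : Fin N → ℂ) (n : Fin N) (l : ℂ) : ℂ :=
  ∏ m ∈ Finset.univ.erase n, Complex.sinh (l - x m) / Complex.sinh (x n - x m)

theorem lagrange_isTrig (x : Fin N → ℂ) (n : Fin N) : IsTrig N (lagrange x n) := by
  have h := (IsTrig.prod_sinh_sub (Finset.univ.erase n) x).const_mul
    (∏ m ∈ Finset.univ.erase n, Complex.sinh (x n - x m))⁻¹
  have hN : (Finset.univ.erase n).card + 1 = N := by
    rw [Finset.card_erase_add_one (Finset.mem_univ n), Finset.card_univ, Fintype.card_fin]
  rw [hN] at h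
  convert h using 2 with l
  rw [lagrange, Finset.prod_div_distrib, div_eq_inv_mul]

theorem lagrange_self {x : Fin N → ℂ} (hx : ∀ i j, i ≠ j → Complex.sinh (x i - x j) ≠ 0)
    (n : Fin N) : lagrange x n (x n) = 1 :=
  Finset.prod_eq_one fun _ hm => div_self (hx _ _ (Finset.ne_of_mem_erase hm).symm)

theorem lagrange_of_ne (x : Fin N → ℂ) {n m : Fin N} (h : m ≠ n) : lagrange x n (x m) = 0 :=
  Finset.prod_eq_zero (Finset.mem_erase.2 ⟨h, Finset.mem_univ _⟩) (by simp)

/-- Nodes distinct modulo iπ become distinct in the variable e^{2λ}, where a polynomial of degree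
less than N has N zeros. -/
theorem IsTrig.eq_zero {f : ℂ → ℂ} (hf : IsTrig N f) {x : Fin N → ℂ}
    (hx : ∀ i j, i ≠ j → Complex.sinh (x i - x j) ≠ 0) (h : ∀ n, f (x n) = 0) (l : ℂ) :
    f l = 0 := by
  obtain ⟨P, hP, hP'⟩ := hf
  have hP0 : P = 0 := by
    refine eq_zero_of_degree_lt_of_eval_index_eq_zero (s := Finset.univ)
      (v := fun n => Complex.exp (2 * x n)) ?_ ?_ ?_
    · intro i _ j _ hij
      by_contra hne
      exact exp_two_mul_injective_of_sinh_ne (hx i j hne) hij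
    · simpa using hP
    · intro n _
      rw [← hP', h, mul_zero]
  have := hP' l
  rw [hP0, eval_zero] at this
  exact (mul_eq_zero.1 this).resolve_left (Complex.exp_ne_zero _)

theorem IsTrig.eq_interpolation {f : ℂ → ℂ} (hf : IsTrig N f) {x : Fin N → ℂ}
    (hx : ∀ i j, i ≠ j → Complex.sinh (x i - x j) ≠ 0) (l : ℂ) :
    f l = ∑ n, lagrange x n l * f (x n) := by
  have hg : IsTrig N (fun l => f l + (-1) * ∑ n, f (x n) * lagrange x n l) :=
    hf.add ((IsTrig.sum _ fun n _ => (lagrange_isTrig x n).const_mul (f (x n))).const_mul (-1))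
  have := hg.eq_zero hx (fun n => ?_) l
  · simp only [mul_comm (lagrange x _ l)]
    linear_combination this
  · rw [Finset.sum_eq_single n]
    · rw [lagrange_self hx]
      ring
    · intro m _ hm
      rw [lagrange_of_ne x hm.symm, mul_zero]
    · simp

end TrigPoly

namespace SpinChain

open YangBaxter TrigPoly

variable {N : ℕ} (c : SpinChain N)

/-! ### Operators acting at one site -/

theorem sum_ite_agree {E : Type*} [AddCommMonoid E] (n : Fin N) (h : c.Conf) (F : c.Conf → E) :
    ∑ k : c.Conf, (if ∀ m, m ≠ n → h m = k m then F k else 0) =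
      ∑ j, F (Function.update h n j) := by
  rw [← Finset.sum_filter]
  have : (Finset.univ.filter fun k : c.Conf => ∀ m, m ≠ n → h m = k m) =
      Finset.univ.image fun j => Function.update h n j := by
    ext k
    simp only [Finset.mem_filter, Finset.mem_univ, true_and, Finset.mem_image]
    constructor
    · intro hk
      refine ⟨k n, ?_⟩
      funext m
      by_cases hm : m = n
      · subst hm; simp
      · simp [hm, hk m hm]
    · rintro ⟨j, rfl⟩ m hm
      simp [hm]
  rw [this, Finset.sum_image fun i _ j _ hij => Function.update_injective h n hij]

theorem siteOp_mul_apply (n : Fin N) (X : Matrix (Fin (c.twoS n + 1)) (Fin (c.twoS n + 1)) ℂ)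
    (Y : c.Op) (h g : c.Conf) :
    (c.siteOp n X * Y) h g = ∑ j, X (h n) j * Y (Function.update h n j) g := by
  rw [Matrix.mul_apply]
  simp only [siteOp, ite_mul, zero_mul]
  rw [sum_ite_agree c n h fun k => X (h n) (k n) * Y k g]
  simp

/-- `siteOp` as a homomorphism of algebras. -/
def siteHom (n : Fin N) : Matrix (Fin (c.twoS n + 1)) (Fin (c.twoS n + 1)) ℂ →ₐ[ℂ] c.Op :=
  AlgHom.ofLinearMap
    { toFun := c.siteOp n
      map_add' := fun X Y => by
        ext h g
        simp only [siteOp, Matrix.add_apply]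
        split_ifs <;> simp
      map_smul' := fun a X => by
        ext h g
        simp only [siteOp, Matrix.smul_apply, RingHom.id_apply]
        split_ifs <;> simp }
    (by
      ext h g
      simp only [LinearMap.coe_mk, AddHom.coe_mk, siteOp, Matrix.one_apply]
      by_cases hg : h = g
      · simp [hg]
      · rw [if_neg hg]
        split_ifs with h1 h2
        · exact absurd (funext fun m => if hm : m = n then hm ▸ h2 else h1 m hm) hg
        · rfl
        · rfl)
    (fun X Y => by
      ext h g
      simp only [LinearMap.coe_mk, AddHom.coe_mk, siteOp_mul_apply]
      simp only [siteOp, Matrix.mul_apply]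
      by_cases hg : ∀ m, m ≠ n → h m = g m
      · rw [if_pos hg]
        refine Finset.sum_congr rfl fun j _ => ?_
        rw [if_pos fun m hm => by simp [hm, hg m hm]]
        simp
      · rw [if_neg hg]
        refine (Finset.sum_eq_zero fun j _ => ?_).symm
        rw [if_neg fun hh => hg fun m hm => by simpa [hm] using hh m hm, mul_zero])

@[simp] theorem siteHom_apply (n : Fin N)
    (X : Matrix (Fin (c.twoS n + 1)) (Fin (c.twoS n + 1)) ℂ) : c.siteHom n X = c.siteOp n X := rfl

theorem siteOp_mul_siteOp_apply {n m : Fin N} (hnm : n ≠ m)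
    (X : Matrix (Fin (c.twoS n + 1)) (Fin (c.twoS n + 1)) ℂ)
    (Y : Matrix (Fin (c.twoS m + 1)) (Fin (c.twoS m + 1)) ℂ) (h g : c.Conf) :
    (c.siteOp n X * c.siteOp m Y) h g =
      if ∀ p, p ≠ n → p ≠ m → h p = g p then X (h n) (g n) * Y (h m) (g m) else 0 := by
  rw [siteOp_mul_apply]
  by_cases hg : ∀ p, p ≠ n → p ≠ m → h p = g p
  · rw [if_pos hg, Finset.sum_eq_single (g n)]
    · rw [siteOp, if_pos]
      · simp [hnm.symm]
      · intro p hp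
        by_cases hpn : p = n
        · subst hpn; simp
        · simp [hpn, hg p hpn hp]
    · intro j _ hj
      rw [siteOp, if_neg, mul_zero]
      intro hh
      exact hj (by simpa using hh n hnm)
    · simp
  · rw [if_neg hg]
    refine Finset.sum_eq_zero fun j _ => ?_
    rw [siteOp, if_neg, mul_zero]
    intro hh
    exact hg fun p hp hp' => by simpa [hp] using hh p hp'

theorem siteOp_commute {n m : Fin N} (hnm : n ≠ m)
    (X : Matrix (Fin (c.twoS n + 1)) (Fin (c.twoS n + 1)) ℂ)
    (Y : Matrix (Fin (c.twoS m + 1)) (Fin (c.twoS m + 1)) ℂ) :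
    Commute (c.siteOp n X) (c.siteOp m Y) := by
  ext h g
  rw [siteOp_mul_siteOp_apply c hnm, siteOp_mul_siteOp_apply c hnm.symm, mul_comm]
  exact if_congr ⟨fun H p hp hp' => H p hp' hp, fun H p hp hp' => H p hp' hp⟩ rfl rfl

/-! ### The Lax operator -/

/-- The Lax operator, with entries acting on the local space. -/
def localLax (n : Fin N) (l : ℂ) :
    Matrix (Fin 2) (Fin 2) (Matrix (Fin (c.twoS n + 1)) (Fin (c.twoS n + 1)) ℂ) :=
  !![Matrix.diagonal fun k => Complex.sinh (l + c.η * c.Sz n k),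
      Complex.sinh c.η • c.Sminus n;
    Complex.sinh c.η • c.Splus n,
      Matrix.diagonal fun k => Complex.sinh (l - c.η * c.Sz n k)]

/-- Relations among the entries need only be checked in the matrix algebra of a single site; the
algebra homomorphism carries them to the chain. -/
theorem lax_eq_map (n : Fin N) (l : ℂ) : c.lax n l = (c.localLax n l).map (c.siteHom n) := by
  ext1 i j
  fin_cases i <;> fin_cases j <;>
    simp [lax, localLax, -siteHom_apply, ← siteHom_apply]

theorem sinh_ne_zero_of_generic (hη : c.Generic) {k : ℤ} (hk : k ≠ 0) :
    Complex.sinh (k * c.η) ≠ 0 := by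
  have key : ∀ m : ℕ, 0 < m → Complex.sinh (m * c.η) ≠ 0 := by
    intro m hm h0
    obtain ⟨n, hn⟩ := sinh_eq_zero_iff.1 h0
    refine hη (2 * m) (by omega) ?_
    rw [← Complex.exp_nat_mul, Complex.exp_eq_one_iff]
    refine ⟨n, ?_⟩
    push_cast
    linear_combination 2 * hn
  obtain ⟨m, rfl | rfl⟩ := k.eq_nat_or_neg
  · have := key m (by omega)
    simpa using this
  · have := key m (by omega)
    simpa [Complex.sinh_neg] using this

theorem sinh_eta_ne_zero (hη : c.Generic) : Complex.sinh c.η ≠ 0 := by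
  simpa using c.sinh_ne_zero_of_generic hη (k := 1) one_ne_zero

/-- Only squares of `x` enter S⁻S⁺ and S⁺S⁻, so the branch of the root plays no role in the
relations. -/
theorem x_sq (hη : c.Generic) (n : Fin N) (k : ℕ) :
    Complex.sinh c.η * Complex.sinh c.η * (c.x n k * c.x n k) =
      Complex.sinh (c.η * k) * Complex.sinh (c.η * (c.twoS n - k + 1)) := by
  have h := c.sinh_eta_ne_zero hη
  have hx : c.x n k * c.x n k = c.qInt (k : ℂ) * c.qInt ((c.twoS n : ℂ) - (k : ℂ) + 1) := by
    rw [← pow_two, x, ← Complex.cpow_nat_mul]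
    norm_num
  rw [hx, qInt, qInt]
  field_simp

theorem Sminus_mul_Splus (hη : c.Generic) (n : Fin N) :
    (Complex.sinh c.η • c.Sminus n) * (Complex.sinh c.η • c.Splus n) =
      Matrix.diagonal fun k : Fin (c.twoS n + 1) => Complex.sinh (c.η * (k : ℕ)) *
        Complex.sinh (c.η * (c.twoS n - (k : ℕ) + 1)) := by
  ext i j
  rw [smul_mul_smul_comm, Matrix.smul_apply, Matrix.mul_apply, Matrix.diagonal_apply, smul_eq_mul]
  simp only [Sminus, Splus]
  by_cases hij : i = j
  · subst hij
    rw [if_pos rfl]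
    -- At the end of the ladder there is no intermediate state, and the closed formula agrees
    -- because sinh(η · 0) = 0.
    rcases Nat.eq_zero_or_pos (i : ℕ) with hi | hi
    · rw [Finset.sum_eq_zero fun k _ => by rw [if_neg (by omega), zero_mul]]
      simp [hi]
    · rw [Finset.sum_eq_single ⟨(i : ℕ) - 1, by omega⟩]
      · rw [if_pos (by simp; omega), if_pos (by simp; omega)]
        have : ((i : ℕ) - 1 + 1) = i := by omega
        simp only [this]
        exact c.x_sq hη n i
      · intro k _ hk
        rw [if_neg, zero_mul]
        intro h
        exact hk (Fin.ext (by simp; omega))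
      · simp
  · rw [if_neg hij, Finset.sum_eq_zero, mul_zero]
    intro k _
    by_cases h1 : (i : ℕ) = k + 1
    · rw [if_neg (c := (j : ℕ) = k + 1) fun h2 => hij (Fin.ext (by omega)), mul_zero]
    · rw [if_neg h1, zero_mul]

theorem Splus_mul_Sminus (hη : c.Generic) (n : Fin N) :
    (Complex.sinh c.η • c.Splus n) * (Complex.sinh c.η • c.Sminus n) =
      Matrix.diagonal fun k : Fin (c.twoS n + 1) => Complex.sinh (c.η * ((k : ℕ) + 1)) *
        Complex.sinh (c.η * (c.twoS n - (k : ℕ))) := by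
  ext i j
  rw [smul_mul_smul_comm, Matrix.smul_apply, Matrix.mul_apply, Matrix.diagonal_apply, smul_eq_mul]
  simp only [Sminus, Splus]
  by_cases hij : i = j
  · subst hij
    rw [if_pos rfl]
    rcases eq_or_ne (i : ℕ) (c.twoS n) with hi | hi
    · rw [Finset.sum_eq_zero fun k _ => by rw [if_neg (by omega), zero_mul]]
      simp [hi]
    · rw [Finset.sum_eq_single ⟨(i : ℕ) + 1, by omega⟩]
      · rw [if_pos rfl]
        refine (c.x_sq hη n (i + 1)).trans ?_
        push_cast
        congr 3
        ring
      · intro k _ hk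
        rw [if_neg, zero_mul]
        intro h
        exact hk (Fin.ext (by simp; omega))
      · simp
  · rw [if_neg hij, Finset.sum_eq_zero, mul_zero]
    intro k _
    by_cases h1 : (k : ℕ) = i + 1
    · rw [if_neg (c := (k : ℕ) = j + 1) fun h2 => hij (Fin.ext (by omega)), mul_zero]
    · rw [if_neg h1, zero_mul]

/-- The addition formula behind all eight exchange relations between a diagonal and an off-diagonal
Lax entry. -/
theorem sinh_exchange (u y e : ℂ) :
    Complex.sinh (u + e) * Complex.sinh y =
      Complex.sinh u * Complex.sinh (y + e) + Complex.sinh e * Complex.sinh (y - u) := by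
  simp only [Complex.sinh_add, Complex.sinh_sub]
  ring

/-- The off-diagonal Lax entries do not depend on the spectral parameter; this cuts the sixteen
entries of the Yang–Baxter relation down to the listed ones. -/
theorem RTT_of_relations {R : Type*} [Ring R] [Algebra ℂ R] {η : ℂ} {A D : ℂ → R} {B C : R}
    (hAA : ∀ l m, A l * A m = A m * A l) (hDD : ∀ l m, D l * D m = D m * D l)
    (hAD : ∀ l m, A l * D m = D m * A l)
    (hAB : ∀ l m, Complex.sinh (l - m + η) • (A l * B) =
      Complex.sinh (l - m) • (B * A l) + Complex.sinh η • (A m * B))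
    (hBA : ∀ l m, Complex.sinh (l - m + η) • (B * A m) =
      Complex.sinh (l - m) • (A m * B) + Complex.sinh η • (B * A l))
    (hDC : ∀ l m, Complex.sinh (l - m + η) • (D l * C) =
      Complex.sinh (l - m) • (C * D l) + Complex.sinh η • (D m * C))
    (hCD : ∀ l m, Complex.sinh (l - m + η) • (C * D m) =
      Complex.sinh (l - m) • (D m * C) + Complex.sinh η • (C * D l))
    (hCA : ∀ l m, Complex.sinh (l - m + η) • (C * A l) =
      Complex.sinh (l - m) • (A l * C) + Complex.sinh η • (C * A m))
    (hAC : ∀ l m, Complex.sinh (l - m + η) • (A m * C) =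
      Complex.sinh (l - m) • (C * A m) + Complex.sinh η • (A l * C))
    (hBD : ∀ l m, Complex.sinh (l - m + η) • (B * D l) =
      Complex.sinh (l - m) • (D l * B) + Complex.sinh η • (B * D m))
    (hDB : ∀ l m, Complex.sinh (l - m + η) • (D m * B) =
      Complex.sinh (l - m) • (B * D m) + Complex.sinh η • (D l * B))
    (hBC : ∀ l m, Complex.sinh (l - m) • (B * C) + Complex.sinh η • (D l * A m) =
      Complex.sinh η • (D m * A l) + Complex.sinh (l - m) • (C * B)) :
    RTT η fun l => !![A l, B; C, D l] := by
  rw [RTT_iff]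
  rintro l m ⟨i, j⟩ ⟨k, n⟩
  have e1 := hAA l m
  have e2 := hDD l m
  have e3 := hAD l m
  have e4 := hAD m l
  have e5 := hAB l m
  have e6 := hBA l m
  have e7 := hDC l m
  have e8 := hCD l m
  have e9 := hCA l m
  have e10 := hAC l m
  have e11 := hBD l m
  have e12 := hDB l m
  have e13 := hBC l m
  fin_cases i <;> fin_cases j <;> fin_cases k <;> fin_cases n <;>
    simp [Fintype.sum_prod_type, rMat, ← Algebra.smul_def, ← Algebra.commutes, e1, e2, e3, e4,
      e5, e6, e7, e8, e9, e10, e11, e12]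
  all_goals first | abel1 | skip
  · exact e13
  · rw [add_comm, add_comm (_ • (B * C))]
    simpa [add_comm] using e13.symm

theorem Sz_of_eq_add_one {n : Fin N} {i j : Fin (c.twoS n + 1)} (h : (i : ℕ) = j + 1) :
    c.Sz n j = c.Sz n i + 1 := by
  simp only [Sz, h]
  push_cast
  ring

/-- A nonzero entry of S⁻ joins states whose Sᶻ differ by one, so a function of Sᶻ is evaluated at z
on its left and at z + 1 on its right, and the operator identity is a scalar identity in z. The
three variants below change the order or replace S⁻ by S⁺. -/
theorem diagonal_exchange_Sminus {n : Fin N} (a b e : ℂ) (f g p : ℂ → ℂ)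
    (h : ∀ z, a * f z = b * g (z + 1) + e * p z) :
    a • (Matrix.diagonal (fun k => f (c.Sz n k)) * (Complex.sinh c.η • c.Sminus n)) =
      b • ((Complex.sinh c.η • c.Sminus n) * Matrix.diagonal (fun k => g (c.Sz n k))) +
      e • (Matrix.diagonal (fun k => p (c.Sz n k)) * (Complex.sinh c.η • c.Sminus n)) := by
  ext i j
  simp only [Matrix.smul_apply, Matrix.add_apply, Matrix.diagonal_mul, Matrix.mul_diagonal,
    Sminus, smul_eq_mul]
  split_ifs with hij
  · rw [c.Sz_of_eq_add_one hij]
    linear_combination (Complex.sinh c.η * c.x n (j + 1)) * h (c.Sz n i)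
  · simp

theorem Sminus_exchange_diagonal {n : Fin N} (a b e : ℂ) (f g p : ℂ → ℂ)
    (h : ∀ z, a * f (z + 1) = b * g z + e * p (z + 1)) :
    a • ((Complex.sinh c.η • c.Sminus n) * Matrix.diagonal (fun k => f (c.Sz n k))) =
      b • (Matrix.diagonal (fun k => g (c.Sz n k)) * (Complex.sinh c.η • c.Sminus n)) +
      e • ((Complex.sinh c.η • c.Sminus n) * Matrix.diagonal (fun k => p (c.Sz n k))) := by
  ext i j
  simp only [Matrix.smul_apply, Matrix.add_apply, Matrix.diagonal_mul, Matrix.mul_diagonal,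
    Sminus, smul_eq_mul]
  split_ifs with hij
  · rw [c.Sz_of_eq_add_one hij]
    linear_combination (Complex.sinh c.η * c.x n (j + 1)) * h (c.Sz n i)
  · simp

theorem diagonal_exchange_Splus {n : Fin N} (a b e : ℂ) (f g p : ℂ → ℂ)
    (h : ∀ z, a * f (z + 1) = b * g z + e * p (z + 1)) :
    a • (Matrix.diagonal (fun k => f (c.Sz n k)) * (Complex.sinh c.η • c.Splus n)) =
      b • ((Complex.sinh c.η • c.Splus n) * Matrix.diagonal (fun k => g (c.Sz n k))) +
      e • (Matrix.diagonal (fun k => p (c.Sz n k)) * (Complex.sinh c.η • c.Splus n)) := by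
  ext i j
  simp only [Matrix.smul_apply, Matrix.add_apply, Matrix.diagonal_mul, Matrix.mul_diagonal,
    Splus, smul_eq_mul]
  split_ifs with hij
  · rw [c.Sz_of_eq_add_one hij]
    linear_combination (Complex.sinh c.η * c.x n j) * h (c.Sz n j)
  · simp

theorem Splus_exchange_diagonal {n : Fin N} (a b e : ℂ) (f g p : ℂ → ℂ)
    (h : ∀ z, a * f z = b * g (z + 1) + e * p z) :
    a • ((Complex.sinh c.η • c.Splus n) * Matrix.diagonal (fun k => f (c.Sz n k))) =
      b • (Matrix.diagonal (fun k => g (c.Sz n k)) * (Complex.sinh c.η • c.Splus n)) +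
      e • ((Complex.sinh c.η • c.Splus n) * Matrix.diagonal (fun k => p (c.Sz n k))) := by
  ext i j
  simp only [Matrix.smul_apply, Matrix.add_apply, Matrix.diagonal_mul, Matrix.mul_diagonal,
    Splus, smul_eq_mul]
  split_ifs with hij
  · rw [c.Sz_of_eq_add_one hij]
    linear_combination (Complex.sinh c.η * c.x n j) * h (c.Sz n j)
  · simp

theorem sinh_mul_sinh_sub (x y t : ℂ) :
    Complex.sinh x * Complex.sinh y - Complex.sinh (x + t) * Complex.sinh (y - t) =
      Complex.sinh t * Complex.sinh (x - y + t) := by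
  have h := Complex.cosh_sq_sub_sinh_sq t
  simp only [Complex.sinh_add, Complex.sinh_sub, Complex.cosh_sub]
  linear_combination (-(Complex.sinh x * Complex.sinh y)) * h

theorem localLax_RTT (hη : c.Generic) (n : Fin N) : RTT c.η (c.localLax n) := by
  have hcomm : ∀ f g : Fin (c.twoS n + 1) → ℂ,
      Matrix.diagonal f * Matrix.diagonal g = Matrix.diagonal g * Matrix.diagonal f := by
    intro f g
    simp only [Matrix.diagonal_mul_diagonal, mul_comm]
  refine RTT_of_relations (fun _ _ => hcomm _ _) (fun _ _ => hcomm _ _) (fun _ _ => hcomm _ _)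
    (fun l m => ?_) (fun l m => ?_) (fun l m => ?_) (fun l m => ?_) (fun l m => ?_)
    (fun l m => ?_) (fun l m => ?_) (fun l m => ?_) (fun l m => ?_)
  · refine c.diagonal_exchange_Sminus _ _ _ (fun z => Complex.sinh (l + c.η * z))
      (fun z => Complex.sinh (l + c.η * z)) (fun z => Complex.sinh (m + c.η * z)) fun z => ?_
    have := sinh_exchange (l - m) (l + c.η * z) c.η
    ring_nf at this ⊢
    exact this
  · refine c.Sminus_exchange_diagonal _ _ _ (fun z => Complex.sinh (m + c.η * z))
      (fun z => Complex.sinh (m + c.η * z)) (fun z => Complex.sinh (l + c.η * z)) fun z => ?_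
    -- Here the shift by η goes the other way, so the identity is used at the opposite argument and
    -- all signs are flipped.
    have := sinh_exchange (l - m) (-(m + c.η * (z + 1))) c.η
    rw [← neg_inj, ← mul_neg, neg_add, ← mul_neg, ← mul_neg, ← Complex.sinh_neg,
      ← Complex.sinh_neg, ← Complex.sinh_neg]
    ring_nf at this ⊢
    exact this
  · refine c.diagonal_exchange_Splus _ _ _ (fun z => Complex.sinh (l - c.η * z))
      (fun z => Complex.sinh (l - c.η * z)) (fun z => Complex.sinh (m - c.η * z)) fun z => ?_
    have := sinh_exchange (l - m) (l - c.η * (z + 1)) c.η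
    ring_nf at this ⊢
    exact this
  · refine c.Splus_exchange_diagonal _ _ _ (fun z => Complex.sinh (m - c.η * z))
      (fun z => Complex.sinh (m - c.η * z)) (fun z => Complex.sinh (l - c.η * z)) fun z => ?_
    have := sinh_exchange (l - m) (-(m - c.η * z)) c.η
    rw [← neg_inj, ← mul_neg, neg_add, ← mul_neg, ← mul_neg, ← Complex.sinh_neg,
      ← Complex.sinh_neg, ← Complex.sinh_neg]
    ring_nf at this ⊢
    exact this
  · refine c.Splus_exchange_diagonal _ _ _ (fun z => Complex.sinh (l + c.η * z))
      (fun z => Complex.sinh (l + c.η * z)) (fun z => Complex.sinh (m + c.η * z)) fun z => ?_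
    have := sinh_exchange (l - m) (l + c.η * z) c.η
    ring_nf at this ⊢
    exact this
  · refine c.diagonal_exchange_Splus _ _ _ (fun z => Complex.sinh (m + c.η * z))
      (fun z => Complex.sinh (m + c.η * z)) (fun z => Complex.sinh (l + c.η * z)) fun z => ?_
    have := sinh_exchange (l - m) (-(m + c.η * (z + 1))) c.η
    rw [← neg_inj, ← mul_neg, neg_add, ← mul_neg, ← mul_neg, ← Complex.sinh_neg,
      ← Complex.sinh_neg, ← Complex.sinh_neg]
    ring_nf at this ⊢
    exact this
  · refine c.Sminus_exchange_diagonal _ _ _ (fun z => Complex.sinh (l - c.η * z))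
      (fun z => Complex.sinh (l - c.η * z)) (fun z => Complex.sinh (m - c.η * z)) fun z => ?_
    have := sinh_exchange (l - m) (l - c.η * (z + 1)) c.η
    ring_nf at this ⊢
    exact this
  · refine c.diagonal_exchange_Sminus _ _ _ (fun z => Complex.sinh (m - c.η * z))
      (fun z => Complex.sinh (m - c.η * z)) (fun z => Complex.sinh (l - c.η * z)) fun z => ?_
    have := sinh_exchange (l - m) (-(m - c.η * z)) c.η
    rw [← neg_inj, ← mul_neg, neg_add, ← mul_neg, ← mul_neg, ← Complex.sinh_neg,
      ← Complex.sinh_neg, ← Complex.sinh_neg]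
    ring_nf at this ⊢
    exact this
  · rw [c.Sminus_mul_Splus hη, c.Splus_mul_Sminus hη]
    simp only [Matrix.diagonal_mul_diagonal, ← Matrix.diagonal_smul, Matrix.diagonal_add]
    congr 1
    funext k
    simp only [Pi.smul_apply, smul_eq_mul]
    -- `h1` computes the commutator of B and C, and `h2` computes D(λ)A(μ) - A(λ)D(μ). Both are
    -- multiples of sinh(2ηSᶻ), with opposite signs.
    have h1 := sinh_mul_sinh_sub (c.η * (k : ℕ)) (c.η * (c.twoS n - (k : ℕ) + 1)) c.η
    have h2 := sinh_mul_sinh_sub (l - c.η * c.Sz n k) (m + c.η * c.Sz n k) (2 * (c.η * c.Sz n k))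
    rw [show c.η * (k : ℕ) + c.η = c.η * ((k : ℕ) + 1) by ring,
      show c.η * (c.twoS n - (k : ℕ) + 1) - c.η = c.η * (c.twoS n - (k : ℕ)) by ring,
      show c.η * (k : ℕ) - c.η * (c.twoS n - (k : ℕ) + 1) + c.η = -(2 * (c.η * c.Sz n k)) by
        rw [Sz, spin]; ring, Complex.sinh_neg] at h1
    rw [show l - c.η * c.Sz n k + 2 * (c.η * c.Sz n k) = l + c.η * c.Sz n k by ring,
      show m + c.η * c.Sz n k - 2 * (c.η * c.Sz n k) = m - c.η * c.Sz n k by ring,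
      show l - c.η * c.Sz n k - (m + c.η * c.Sz n k) + 2 * (c.η * c.Sz n k) = l - m by ring] at h2
    linear_combination Complex.sinh (l - m) * h1 + Complex.sinh c.η * h2

theorem HasQDet_of_relations {R : Type*} [Ring R] [Algebra ℂ R] {η : ℂ} {A D : ℂ → R} {B C : R}
    {q : ℂ → ℂ} (hAD : ∀ l m, A l * D m = D m * A l) (hAB : ∀ l, A l * B = B * A (l - η))
    (hCA : ∀ l, C * A l = A (l - η) * C) (hCD : ∀ l, C * D (l - η) = D l * C)
    (hDB : ∀ l, D (l - η) * B = B * D l) (hBC : ∀ l, A l * D (l - η) - B * C = q l • (1 : R))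
    (hCB : ∀ l, D l * A (l - η) - C * B = q l • (1 : R)) :
    HasQDet η (fun l => !![A l, B; C, D l]) q := by
  intro l
  constructor <;> ext i j <;> fin_cases i <;> fin_cases j <;>
    simp only [adj, Matrix.mul_apply, Fin.sum_univ_two, Matrix.smul_apply] <;> simp
  · rw [← sub_eq_add_neg, hBC]
  · rw [hAB, neg_add_cancel]
  · rw [hCD, add_neg_cancel]
  · rw [neg_add_eq_sub, hCB]
  · rw [← hAD, ← sub_eq_add_neg, hBC]
  · rw [hDB, add_neg_cancel]
  · rw [hCA, neg_add_cancel]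
  · rw [neg_add_eq_sub, hAD, hCB]

theorem localLax_HasQDet (hη : c.Generic) (n : Fin N) :
    HasQDet c.η (c.localLax n) fun l =>
      Complex.sinh (l + c.spin n * c.η) * Complex.sinh (l - c.η - c.spin n * c.η) := by
  refine HasQDet_of_relations (fun l m => ?_) (fun l => ?_) (fun l => ?_) (fun l => ?_)
    (fun l => ?_) (fun l => ?_) (fun l => ?_)
  · simp only [Matrix.diagonal_mul_diagonal, mul_comm]
  · have := c.diagonal_exchange_Sminus (n := n) 1 1 0 (fun z => Complex.sinh (l + c.η * z))
      (fun z => Complex.sinh (l - c.η + c.η * z)) (fun _ => 0) (fun z => by ring_nf)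
    simpa using this
  · have := c.Splus_exchange_diagonal (n := n) 1 1 0 (fun z => Complex.sinh (l + c.η * z))
      (fun z => Complex.sinh (l - c.η + c.η * z)) (fun _ => 0) (fun z => by ring_nf)
    simpa using this
  · have := c.Splus_exchange_diagonal (n := n) 1 1 0 (fun z => Complex.sinh (l - c.η - c.η * z))
      (fun z => Complex.sinh (l - c.η * z)) (fun _ => 0) (fun z => by ring_nf)
    simpa using this
  · have := c.diagonal_exchange_Sminus (n := n) 1 1 0 (fun z => Complex.sinh (l - c.η - c.η * z))
      (fun z => Complex.sinh (l - c.η * z)) (fun _ => 0) (fun z => by ring_nf)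
    simpa using this
  · rw [c.Sminus_mul_Splus hη, Matrix.diagonal_mul_diagonal, Matrix.diagonal_sub,
      Matrix.smul_one_eq_diagonal]
    congr 1
    funext k
    -- The shift ηk turns Sᶻ = s - k into s, which removes the dependence on k and leaves a scalar.
    have h := sinh_mul_sinh_sub (l + c.η * c.Sz n k) (l - c.η - c.η * c.Sz n k) (c.η * (k : ℕ))
    rw [show l + c.η * c.Sz n k + c.η * (k : ℕ) = l + c.spin n * c.η by rw [Sz]; ring,
      show l - c.η - c.η * c.Sz n k - c.η * (k : ℕ) = l - c.η - c.spin n * c.η by rw [Sz]; ring,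
      show l + c.η * c.Sz n k - (l - c.η - c.η * c.Sz n k) + c.η * (k : ℕ) =
        c.η * (c.twoS n - (k : ℕ) + 1) by rw [Sz, spin]; ring] at h
    linear_combination h
  · rw [c.Splus_mul_Sminus hη, Matrix.diagonal_mul_diagonal, Matrix.diagonal_sub,
      Matrix.smul_one_eq_diagonal]
    congr 1
    funext k
    -- The shift η(2s - k) plays the same role here, since -Sᶻ + (2s - k) = s.
    have h := sinh_mul_sinh_sub (l - c.η * c.Sz n k) (l - c.η + c.η * c.Sz n k)
      (c.η * (c.twoS n - (k : ℕ)))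
    rw [show l - c.η * c.Sz n k + c.η * (c.twoS n - (k : ℕ)) = l + c.spin n * c.η by
        rw [Sz, spin]; ring,
      show l - c.η + c.η * c.Sz n k - c.η * (c.twoS n - (k : ℕ)) = l - c.η - c.spin n * c.η by
        rw [Sz, spin]; ring,
      show l - c.η * c.Sz n k - (l - c.η + c.η * c.Sz n k) + c.η * (c.twoS n - (k : ℕ)) =
        c.η * ((k : ℕ) + 1) by rw [Sz, spin]; ring] at h
    linear_combination h

/-! ### Transport of the relations by shifts and homomorphisms -/

theorem RTT_shift {R : Type*} [Ring R] [Algebra ℂ R] {η : ℂ} {M : ℂ → Matrix (Fin 2) (Fin 2) R}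
    (h : RTT η M) (a : ℂ) : RTT η fun l => M (l - a) := by
  intro l m
  have := h (l - a) (m - a)
  rwa [sub_sub_sub_cancel_right] at this

theorem RTT_map {R S : Type*} [Ring R] [Algebra ℂ R] [Ring S] [Algebra ℂ S] {η : ℂ}
    {M : ℂ → Matrix (Fin 2) (Fin 2) R} (h : RTT η M) (φ : R →ₐ[ℂ] S) :
    RTT η fun l => (M l).map φ := by
  rw [RTT_iff] at h ⊢
  intro l m p q
  have hR : ∀ p q, φ (rMat R η (l - m) p q) = rMat S η (l - m) p q := by
    intro p q
    simp only [rMat]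
    split_ifs <;> simp
  have := congrArg φ (h l m p q)
  simpa only [map_sum, map_mul, hR, Matrix.map_apply] using this

theorem HasQDet_shift {R : Type*} [Ring R] [Algebra ℂ R] {η : ℂ}
    {M : ℂ → Matrix (Fin 2) (Fin 2) R} {q : ℂ → ℂ} (h : HasQDet η M q) (a : ℂ) :
    HasQDet η (fun l => M (l - a)) (fun l => q (l - a)) := by
  intro l
  have := h (l - a)
  rwa [sub_right_comm l a η] at this

theorem HasQDet_map {R S : Type*} [Ring R] [Algebra ℂ R] [Ring S] [Algebra ℂ S] {η : ℂ}
    {M : ℂ → Matrix (Fin 2) (Fin 2) R} {q : ℂ → ℂ} (h : HasQDet η M q) (φ : R →ₐ[ℂ] S) :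
    HasQDet η (fun l => (M l).map φ) q := by
  have hadj : ∀ X : Matrix (Fin 2) (Fin 2) R, adj (X.map φ) = (adj X).map φ := by
    intro X
    ext i j
    fin_cases i <;> fin_cases j <;> simp [adj]
  have hone : ∀ z : ℂ, (z • (1 : Matrix (Fin 2) (Fin 2) R)).map φ =
      z • (1 : Matrix (Fin 2) (Fin 2) S) := by
    intro z
    ext i j
    simp only [Matrix.map_apply, Matrix.smul_apply, Matrix.one_apply]
    split_ifs <;> simp
  intro l
  have h1 := congrArg (fun X => X.map φ) (h l).1
  have h2 := congrArg (fun X => X.map φ) (h l).2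
  simp only [Matrix.map_mul, hone] at h1 h2
  exact ⟨by rw [hadj, h1], by rw [hadj, h2]⟩

theorem lax_RTT (hη : c.Generic) (n : Fin N) : RTT c.η (c.lax n) := by
  have := RTT_map (c.localLax_RTT hη n) (c.siteHom n)
  simpa only [← lax_eq_map] using this

theorem lax_HasQDet (hη : c.Generic) (n : Fin N) :
    HasQDet c.η (c.lax n) fun l =>
      Complex.sinh (l + c.spin n * c.η) * Complex.sinh (l - c.η - c.spin n * c.η) := by
  have := HasQDet_map (c.localLax_HasQDet hη n) (c.siteHom n)
  simpa only [← lax_eq_map] using this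

theorem lax_commute {n m : Fin N} (hnm : n ≠ m) (l l' : ℂ) (i j k p : Fin 2) :
    Commute (c.lax n l i j) (c.lax m l' k p) := by
  rw [lax_eq_map, lax_eq_map]
  exact c.siteOp_commute hnm _ _

/-! ### The monodromy matrix of a list of sites -/

/-- The monodromy matrix of the sites in `L`. -/
def mono (L : List (Fin N)) (l : ℂ) : Matrix (Fin 2) (Fin 2) c.Op :=
  (L.map fun n => c.lax n (l - c.ξ n)).prod

theorem mono_cons (n : Fin N) (L : List (Fin N)) (l : ℂ) :
    c.mono (n :: L) l = c.lax n (l - c.ξ n) * c.mono L l := by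
  simp [mono]

theorem mono_nil (l : ℂ) : c.mono [] l = 1 := rfl

theorem mono_cons_apply (n : Fin N) (L : List (Fin N)) (l : ℂ) (i j : Fin 2) :
    c.mono (n :: L) l i j = c.lax n (l - c.ξ n) i 0 * c.mono L l 0 j +
      c.lax n (l - c.ξ n) i 1 * c.mono L l 1 j := by
  rw [mono_cons, Matrix.mul_apply, Fin.sum_univ_two]

theorem lax_commute_mono {n : Fin N} {L : List (Fin N)} (h : n ∉ L) (l m : ℂ) (i j k p : Fin 2) :
    Commute (c.lax n l i j) (c.mono L m k p) := by
  induction L generalizing k p with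
  | nil =>
    rw [mono_nil, Matrix.one_apply]
    split_ifs
    · exact Commute.one_right _
    · exact Commute.zero_right _
  | cons a L ih =>
    simp only [List.mem_cons, not_or] at h
    rw [mono_cons_apply]
    exact ((c.lax_commute h.1 _ _ _ _ _ _).mul_right (ih h.2 _ _)).add_right
      ((c.lax_commute h.1 _ _ _ _ _ _).mul_right (ih h.2 _ _))

theorem mono_RTT (hη : c.Generic) {L : List (Fin N)} (hL : L.Nodup) : RTT c.η (c.mono L) := by
  induction L with
  | nil => exact RTT_one c.η
  | cons n L ih =>
    rw [List.nodup_cons] at hL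
    have := (RTT_shift (c.lax_RTT hη n) (c.ξ n)).mul (ih hL.2)
      fun l m i j k p => c.lax_commute_mono hL.1 _ _ _ _ _ _
    simpa only [← mono_cons] using this

theorem mono_HasQDet (hη : c.Generic) {L : List (Fin N)} (hL : L.Nodup) :
    HasQDet c.η (c.mono L) fun l => (L.map fun n =>
      Complex.sinh (l - c.ξ n + c.spin n * c.η) *
        Complex.sinh (l - c.ξ n - c.η - c.spin n * c.η)).prod := by
  induction L with
  | nil => exact HasQDet_one c.η
  | cons n L ih =>
    rw [List.nodup_cons] at hL
    have := (HasQDet_shift (c.lax_HasQDet hη n) (c.ξ n)).mul (ih hL.2)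
      fun l m i j k p => c.lax_commute_mono hL.1 _ _ _ _ _ _
    simpa only [← mono_cons, List.map_cons, List.prod_cons] using this

theorem siteOp_diagonal (n : Fin N) (f : Fin (c.twoS n + 1) → ℂ) :
    c.siteOp n (Matrix.diagonal f) = Matrix.diagonal fun h => f (h n) := by
  ext h g
  simp only [siteOp, Matrix.diagonal_apply]
  by_cases hg : h = g
  · simp [hg]
  · rw [if_neg hg]
    split_ifs with h1 h2
    · exact absurd (funext fun m => if hm : m = n then hm ▸ h2 else h1 m hm) hg
    · rfl
    · rfl

theorem lax_A (n : Fin N) (l : ℂ) : c.lax n l 0 0 =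
    Matrix.diagonal fun h => Complex.sinh (l + c.η * c.Sz n (h n)) :=
  c.siteOp_diagonal n _

theorem lax_D (n : Fin N) (l : ℂ) : c.lax n l 1 1 =
    Matrix.diagonal fun h => Complex.sinh (l - c.η * c.Sz n (h n)) :=
  c.siteOp_diagonal n _

theorem lax_diag_isTrig (n : Fin N) (i : Fin 2) (h g : c.Conf) :
    IsTrig 2 fun l => c.lax n (l - c.ξ n) i i h g := by
  fin_cases i
  · simp only [Fin.zero_eta, lax_A, Matrix.diagonal_apply]
    split_ifs with hg
    · convert IsTrig.sinh_sub (c.ξ n - c.η * c.Sz n (h n)) using 3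
      ring
    · exact IsTrig.zero 2
  · simp only [Fin.mk_one, lax_D, Matrix.diagonal_apply]
    split_ifs with hg
    · convert IsTrig.sinh_sub (c.ξ n + c.η * c.Sz n (h n)) using 3
      ring
    · exact IsTrig.zero 2

theorem lax_offdiag_isTrig (n : Fin N) {i j : Fin 2} (hij : i ≠ j) (h g : c.Conf) :
    IsTrig 1 fun l => c.lax n (l - c.ξ n) i j h g := by
  fin_cases i <;> fin_cases j
  · exact absurd rfl hij
  · exact IsTrig.const _
  · exact IsTrig.const _
  · exact absurd rfl hij

/-- An off-diagonal entry contains an odd number of off-diagonal Lax entries, which are constant in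
λ, so B and C have degree one less than A and D. This is why N nodes suffice to interpolate the
transfer matrix. -/
theorem mono_isTrig (L : List (Fin N)) (h g : c.Conf) (i : Fin 2) :
    IsTrig (L.length + 1) (fun l => c.mono L l i i h g) ∧
      ∀ j, i ≠ j → IsTrig L.length (fun l => c.mono L l i j h g) := by
  induction L generalizing h g i with
  | nil =>
    refine ⟨IsTrig.const _, fun j hj => ?_⟩
    simp only [mono_nil, Matrix.one_apply_ne hj]
    exact IsTrig.zero _
  | cons n L ih =>
    have key : ∀ j, (fun l => c.mono (n :: L) l i j h g) = fun l =>
        ∑ a, ∑ k, c.lax n (l - c.ξ n) i a h k * c.mono L l a j k g := by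
      intro j
      funext l
      rw [mono_cons, Matrix.mul_apply, Matrix.sum_apply]
      simp only [Matrix.mul_apply]
    constructor
    · rw [key]
      refine IsTrig.sum _ fun a _ => IsTrig.sum _ fun k _ => ?_
      by_cases ha : i = a
      · subst ha
        have := (c.lax_diag_isTrig n i h k).mul (ih k g i).1
        rwa [Nat.add_comm 1] at this
      · have := (c.lax_offdiag_isTrig n ha h k).mul ((ih k g a).2 i (Ne.symm ha))
        rw [Nat.zero_add] at this
        -- Two off-diagonal factors lose two degrees in all, so the parity is the right one.
        exact this.add_two
    · intro j hj
      rw [key]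
      refine IsTrig.sum _ fun a _ => IsTrig.sum _ fun k _ => ?_
      by_cases ha : i = a
      · subst ha
        have := (c.lax_diag_isTrig n i h k).mul ((ih k g i).2 j hj)
        rwa [Nat.add_comm 1] at this
      · have haj : a = j := by omega
        subst haj
        have := (c.lax_offdiag_isTrig n ha h k).mul (ih k g a).1
        rwa [Nat.zero_add] at this

/-! ### The reference state -/

/-- The product basis vector with label `(0, …, 0)`. -/
def vac : c.States := Pi.single (fun _ => 0) 1

theorem diagonal_mulVec_vac (f : c.Conf → ℂ) :
    (Matrix.diagonal f).mulVec c.vac = f (fun _ => 0) • c.vac := by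
  funext h
  rw [Matrix.mulVec_diagonal, vac, Pi.smul_apply, smul_eq_mul, Pi.single_apply]
  split_ifs with hh
  · rw [hh]
  · simp

theorem vac_vecMul_diagonal (f : c.Conf → ℂ) :
    Matrix.vecMul c.vac (Matrix.diagonal f) = f (fun _ => 0) • c.vac := by
  funext h
  rw [Matrix.vecMul_diagonal, vac, Pi.smul_apply, smul_eq_mul, Pi.single_apply, mul_comm]
  split_ifs with hh
  · rw [hh]
  · simp

theorem Sz_zero (n : Fin N) : c.Sz n 0 = c.spin n := by
  simp [Sz]

theorem lax_D_mulVec_vac (n : Fin N) (l : ℂ) :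
    (c.lax n l 1 1).mulVec c.vac = Complex.sinh (l - c.spin n * c.η) • c.vac := by
  rw [lax_D, diagonal_mulVec_vac, Sz_zero, mul_comm]

theorem lax_C_mulVec_vac (n : Fin N) (l : ℂ) : (c.lax n l 1 0).mulVec c.vac = 0 := by
  simp only [lax, Matrix.of_apply, Matrix.cons_val_one, Matrix.cons_val_zero]
  funext h
  rw [Matrix.smul_mulVec, vac, Matrix.mulVec_single_one]
  simp [siteOp, Splus, Matrix.col]

theorem vac_vecMul_lax_A (n : Fin N) (l : ℂ) :
    Matrix.vecMul c.vac (c.lax n l 0 0) = Complex.sinh (l + c.spin n * c.η) • c.vac := by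
  rw [lax_A, vac_vecMul_diagonal, Sz_zero, mul_comm]

theorem vac_vecMul_lax_D (n : Fin N) (l : ℂ) :
    Matrix.vecMul c.vac (c.lax n l 1 1) = Complex.sinh (l - c.spin n * c.η) • c.vac := by
  rw [lax_D, vac_vecMul_diagonal, Sz_zero, mul_comm]

theorem vac_vecMul_lax_B (n : Fin N) (l : ℂ) : Matrix.vecMul c.vac (c.lax n l 0 1) = 0 := by
  simp only [lax, Matrix.of_apply, Matrix.cons_val_one, Matrix.cons_val_zero]
  funext h
  rw [Matrix.vecMul_smul, vac, Matrix.single_one_vecMul]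
  simp [siteOp, Sminus, Matrix.row]

/-- The local factor commutes with the rest of the product and may act first; S⁺ kills the reference
state, so only the purely diagonal term survives. -/
theorem mono_D_mulVec_vac {L : List (Fin N)} (hL : L.Nodup) (l : ℂ) :
    (c.mono L l 1 1).mulVec c.vac =
      (L.map fun n => Complex.sinh (l - c.ξ n - c.spin n * c.η)).prod • c.vac := by
  induction L with
  | nil => simp [mono_nil]
  | cons n L ih =>
    rw [List.nodup_cons] at hL
    rw [mono_cons_apply, (c.lax_commute_mono hL.1 _ _ _ _ _ _).eq, Matrix.add_mulVec,
      ← Matrix.mulVec_mulVec, ← Matrix.mulVec_mulVec, lax_C_mulVec_vac, Matrix.mulVec_zero,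
      zero_add, ih hL.2, Matrix.mulVec_smul, lax_D_mulVec_vac, smul_smul, List.map_cons,
      List.prod_cons, mul_comm]

theorem vac_vecMul_mono_B (L : List (Fin N)) (l : ℂ) :
    Matrix.vecMul c.vac (c.mono L l 0 1) = 0 := by
  induction L with
  | nil => simp [mono_nil]
  | cons n L ih =>
    rw [mono_cons_apply, Matrix.vecMul_add, ← Matrix.vecMul_vecMul, ← Matrix.vecMul_vecMul,
      vac_vecMul_lax_A, vac_vecMul_lax_B, Matrix.smul_vecMul, ih, smul_zero, Matrix.zero_vecMul,
      add_zero]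

theorem vac_vecMul_mono_D {L : List (Fin N)} (hL : L.Nodup) (l : ℂ) :
    Matrix.vecMul c.vac (c.mono L l 1 1) =
      (L.map fun n => Complex.sinh (l - c.ξ n - c.spin n * c.η)).prod • c.vac := by
  induction L with
  | nil => simp [mono_nil]
  | cons n L ih =>
    rw [List.nodup_cons] at hL
    rw [mono_cons_apply, (c.lax_commute_mono hL.1 _ _ _ _ _ _).eq, Matrix.vecMul_add,
      ← Matrix.vecMul_vecMul, ← Matrix.vecMul_vecMul, vac_vecMul_mono_B, Matrix.zero_vecMul,
      zero_add, vac_vecMul_lax_D, Matrix.smul_vecMul, ih hL.2, smul_smul, List.map_cons,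
      List.prod_cons]

/-! ### The grading by the total spin -/

/-- The operator `r ^ (h₁ + ⋯ + h_N)`. -/
def grading (r : ℂ) : c.Op := Matrix.diagonal fun h => r ^ (∑ n, (h n : ℕ))

theorem sum_eq_add_one {n : Fin N} {h g : c.Conf} (hg : ∀ m, m ≠ n → h m = g m)
    (hn : (h n : ℕ) = g n + 1) : ∑ m, (h m : ℕ) = ∑ m, (g m : ℕ) + 1 := by
  rw [← Finset.add_sum_erase _ _ (Finset.mem_univ n), ← Finset.add_sum_erase _ _ (Finset.mem_univ n),
    hn, Finset.sum_congr rfl fun m hm => by rw [hg m (Finset.ne_of_mem_erase hm)]]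
  ring

/-- The Lax operator conserves the total spin of site and auxiliary space: it commutes with the
grading tensored with diag(1, r). Powers of r are kept on both sides so that no inverse is needed.
-/
theorem grading_lax (r : ℂ) (n : Fin N) (l : ℂ) (i j : Fin 2) :
    r ^ (i : ℕ) • (c.grading r * c.lax n l i j) = r ^ (j : ℕ) • (c.lax n l i j * c.grading r) := by
  fin_cases i <;> fin_cases j
  · simp [lax, siteOp_diagonal, grading, Matrix.diagonal_mul_diagonal, mul_comm]
  · ext h g
    simp only [lax, grading, Matrix.smul_apply, Matrix.diagonal_mul, Matrix.mul_diagonal]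
    simp only [siteOp, Sminus, Fin.zero_eta, Fin.mk_one, Matrix.of_apply, Matrix.cons_val_zero,
      Matrix.cons_val_one, Matrix.smul_apply, smul_eq_mul]
    split_ifs with h1 h2
    · rw [c.sum_eq_add_one h1 h2]
      ring
    · simp
    · simp
  · ext h g
    simp only [lax, grading, Matrix.smul_apply, Matrix.diagonal_mul, Matrix.mul_diagonal]
    simp only [siteOp, Splus, Fin.zero_eta, Fin.mk_one, Matrix.of_apply, Matrix.cons_val_zero,
      Matrix.cons_val_one, Matrix.smul_apply, smul_eq_mul]
    split_ifs with h1 h2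
    · rw [c.sum_eq_add_one (fun m hm => (h1 m hm).symm) h2]
      ring
    · simp
    · simp
  · simp [lax, siteOp_diagonal, grading, Matrix.diagonal_mul_diagonal, mul_comm]

theorem grading_mono (r : ℂ) (L : List (Fin N)) (l : ℂ) (i j : Fin 2) :
    r ^ (i : ℕ) • (c.grading r * c.mono L l i j) =
      r ^ (j : ℕ) • (c.mono L l i j * c.grading r) := by
  induction L generalizing i j with
  | nil =>
    rw [mono_nil, Matrix.one_apply]
    split_ifs with h
    · rw [h, mul_one, one_mul]
    · simp
  | cons n L ih =>
    have key : ∀ a : Fin 2, r ^ (i : ℕ) • (c.grading r * (c.lax n (l - c.ξ n) i a * c.mono L l a j))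
        = r ^ (j : ℕ) • (c.lax n (l - c.ξ n) i a * c.mono L l a j * c.grading r) := by
      intro a
      rw [← mul_assoc, ← smul_mul_assoc, grading_lax, smul_mul_assoc, mul_assoc, ← mul_smul_comm,
        ih, mul_smul_comm, mul_assoc]
    rw [mono_cons_apply, mul_add, add_mul, smul_add, smul_add, key, key]

/-! ### The monodromy matrix of the chain -/

/-- The sites of the chain, from the last one to the first one. -/
def sites (N : ℕ) : List (Fin N) := (List.finRange N).reverse

theorem sites_nodup : (sites N).Nodup := List.nodup_reverse.2 (List.nodup_finRange N)

theorem sites_length : (sites N).length = N := by simp [sites]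

theorem prod_map_sites (f : Fin N → ℂ) : ((sites N).map f).prod = ∏ n, f n := by
  rw [sites, List.map_reverse, List.prod_reverse, ← List.ofFn_eq_map, List.prod_ofFn]

theorem monodromy_eq_mono (l : ℂ) : c.monodromy l = c.mono (sites N) l := by
  rw [monodromy, mono, sites, List.map_reverse, List.ofFn_eq_map]

/-- The entry `D(λ)` of the monodromy matrix. -/
def opD (l : ℂ) : c.Op := c.monodromy l 1 1

theorem monodromy_RTT (hη : c.Generic) : RTT c.η c.monodromy := by
  rw [funext c.monodromy_eq_mono]
  exact c.mono_RTT hη sites_nodup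

theorem monodromy_HasQDet (hη : c.Generic) :
    HasQDet c.η c.monodromy fun l => c.a l * c.d (l - c.η) := by
  rw [funext c.monodromy_eq_mono]
  have := c.mono_HasQDet hη (sites_nodup (N := N))
  simp only [prod_map_sites, Finset.prod_mul_distrib] at this
  have e : (fun l => c.a l * c.d (l - c.η)) = fun l =>
      (∏ n, Complex.sinh (l - c.ξ n + c.spin n * c.η)) *
        ∏ n, Complex.sinh (l - c.ξ n - c.η - c.spin n * c.η) := by
    funext l
    simp only [a, d, sub_right_comm l c.η]
  rwa [e]

theorem opB_isTrig (h g : c.Conf) : IsTrig N fun l => c.opB l h g := by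
  have := (c.mono_isTrig (sites N) h g 0).2 1 (by decide)
  rw [sites_length] at this
  simpa only [opB, monodromy_eq_mono] using this

theorem opC_isTrig (h g : c.Conf) : IsTrig N fun l => c.opC l h g := by
  have := (c.mono_isTrig (sites N) h g 1).2 0 (by decide)
  rw [sites_length] at this
  simpa only [opC, monodromy_eq_mono] using this

theorem opD_isTrig (h g : c.Conf) : IsTrig (N + 1) fun l => c.opD l h g := by
  have := (c.mono_isTrig (sites N) h g 1).1
  rw [sites_length] at this
  simpa only [opD, monodromy_eq_mono] using this

theorem opD_mulVec_vac (l : ℂ) : (c.opD l).mulVec c.vac = c.d l • c.vac := by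
  rw [opD, monodromy_eq_mono, mono_D_mulVec_vac c sites_nodup, prod_map_sites, d]

theorem vac_vecMul_opD (l : ℂ) : Matrix.vecMul c.vac (c.opD l) = c.d l • c.vac := by
  rw [opD, monodromy_eq_mono, vac_vecMul_mono_D c sites_nodup, prod_map_sites, d]

theorem transfer_isTrig (κ : ℂ) (h g : c.Conf) : IsTrig N fun l => c.transfer κ l h g := by
  simp only [transfer, Matrix.add_apply, Matrix.smul_apply, smul_eq_mul]
  exact ((c.opB_isTrig h g).const_mul _).add ((c.opC_isTrig h g).const_mul _)

theorem continuous_matrix {M : ℂ → c.Op} {k : ℕ} (h : ∀ i j, IsTrig k fun l => M l i j) :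
    Continuous M :=
  continuous_pi fun i => continuous_pi fun j => (h i j).continuous

/-- `sinh (u + η)` and `sinh (-u + η)` do not vanish simultaneously. -/
theorem eq_of_sinh_add_smul_eq (hη : c.Generic) {E : Type*} [AddCommGroup E] [Module ℂ E] {u : ℂ}
    {X Y : E} (h1 : Complex.sinh (u + c.η) • X = Complex.sinh (u + c.η) • Y)
    (h2 : Complex.sinh (-u + c.η) • X = Complex.sinh (-u + c.η) • Y) : X = Y := by
  by_cases h : Complex.sinh (u + c.η) = 0
  · refine smul_right_injective E (r := Complex.sinh (-u + c.η)) ?_ h2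
    intro h'
    obtain ⟨a, ha⟩ := sinh_eq_zero_iff.1 h
    obtain ⟨b, hb⟩ := sinh_eq_zero_iff.1 h'
    refine c.sinh_ne_zero_of_generic hη two_ne_zero (sinh_eq_zero_iff.2 ⟨a + b, ?_⟩)
    push_cast
    linear_combination ha + hb
  · exact smul_right_injective E h h1

/-- The relation and its exchange under λ ↔ μ carry the coefficients sinh(η ± (λ - μ)), at least one
of which is nonzero. -/
theorem opB_commute (hη : c.Generic) (l m : ℂ) : Commute (c.opB l) (c.opB m) := by
  have h1 := (c.monodromy_RTT hη).B_B l m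
  have h2 := (c.monodromy_RTT hη).B_B m l
  rw [← neg_sub l m] at h2
  exact c.eq_of_sinh_add_smul_eq hη h1 h2.symm

theorem opC_commute (hη : c.Generic) (l m : ℂ) : Commute (c.opC l) (c.opC m) := by
  have h1 := (c.monodromy_RTT hη).C_C l m
  have h2 := (c.monodromy_RTT hη).C_C m l
  rw [← neg_sub l m] at h2
  exact c.eq_of_sinh_add_smul_eq hη h1 h2.symm

/-- In the sum of the B–C relation and its exchange under λ ↔ μ the D–A terms cancel. What remains
is sinh(λ - μ) times the claim, and the factor is removed by continuity. -/
theorem opB_opC_exchange (hη : c.Generic) (l m : ℂ) :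
    c.opB l * c.opC m + c.opC l * c.opB m = c.opB m * c.opC l + c.opC m * c.opB l := by
  have hB : Continuous c.opB := c.continuous_matrix c.opB_isTrig
  have hC : Continuous c.opC := c.continuous_matrix c.opC_isTrig
  refine eq_of_sinh_smul_eq (f := fun l => c.opB l * c.opC m + c.opC l * c.opB m)
    (g := fun l => c.opB m * c.opC l + c.opC m * c.opB l) m ?_ ?_ (fun l => ?_) l
  · exact (hB.matrix_mul continuous_const).add (hC.matrix_mul continuous_const)
  · exact (continuous_const.matrix_mul hC).add (continuous_const.matrix_mul hB)
  · have h1 := (c.monodromy_RTT hη).B_C l m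
    have h2 := (c.monodromy_RTT hη).B_C m l
    rw [← neg_sub l m, Complex.sinh_neg] at h2
    simp only [neg_smul] at h2
    simp only [opB, opC, smul_add]
    rw [← sub_eq_zero] at h1 h2 ⊢
    rw [← add_zero (0 : c.Op)]
    nth_rewrite 1 [← h1]
    rw [← h2]
    abel

theorem transfer_commute (hη : c.Generic) {κ : ℂ} (hκ : κ ≠ 0) (l m : ℂ) :
    Commute (c.transfer κ l) (c.transfer κ m) := by
  have h1 := (c.opB_commute hη l m).eq
  have h2 := (c.opC_commute hη l m).eq
  have h3 := c.opB_opC_exchange hη l m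
  rw [Commute, SemiconjBy]
  simp only [transfer, add_mul, mul_add, smul_mul_smul_comm, mul_inv_cancel₀ hκ,
    inv_mul_cancel₀ hκ, one_smul, h1, h2]
  rw [← sub_eq_zero] at h3 ⊢
  rw [← h3]
  abel

/-- The invertible grading operator with r = κ/κ' intertwines the two transfer matrices, so it
carries eigenvectors to eigenvectors with the same eigenvalue. -/
theorem eigenvalueFunctions_subset {κ κ' : ℂ} (hκ : κ ≠ 0) (hκ' : κ' ≠ 0) :
    c.eigenvalueFunctions κ ⊆ c.eigenvalueFunctions κ' := by
  rintro t ⟨v, hv, ht⟩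
  set r := κ / κ' with hr
  have hr0 : r ≠ 0 := div_ne_zero hκ hκ'
  have hB : ∀ l, c.opB l * c.grading r = r⁻¹ • (c.grading r * c.opB l) := by
    intro l
    have := c.grading_mono r (sites N) l 0 1
    simp only [Fin.val_zero, Fin.val_one, pow_zero, pow_one, one_smul, ← monodromy_eq_mono] at this
    rw [opB, this, smul_smul, inv_mul_cancel₀ hr0, one_smul]
  have hC : ∀ l, c.opC l * c.grading r = r • (c.grading r * c.opC l) := by
    intro l
    have := c.grading_mono r (sites N) l 1 0
    simp only [Fin.val_zero, Fin.val_one, pow_zero, pow_one, one_smul, ← monodromy_eq_mono] at this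
    rw [opC, this]
  have hT : ∀ l, c.transfer κ' l * c.grading r = c.grading r * c.transfer κ l := by
    intro l
    simp only [transfer, add_mul, mul_add, smul_mul_assoc, mul_smul_comm, hB, hC, smul_smul]
    congr 2
    · rw [hr]
      field_simp
    · rw [hr]
      field_simp
  refine ⟨(c.grading r).mulVec v, fun h0 => hv ?_, fun l => ?_⟩
  · funext h
    have := congrFun h0 h
    rw [grading, Matrix.mulVec_diagonal, Pi.zero_apply] at this
    exact (mul_eq_zero.1 this).resolve_left (pow_ne_zero _ hr0)
  · rw [Matrix.mulVec_mulVec, hT, ← Matrix.mulVec_mulVec, ht, Matrix.mulVec_smul]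

/-! ### The inhomogeneities -/

variable {c} in
theorem CondInh.sinh_ne_zero (hc : c.CondInh) {n m : Fin N} (hnm : n ≠ m) {i j : ℕ}
    (hi : i ≤ c.twoS n) (hj : j ≤ c.twoS m) : Complex.sinh (c.ξs n i - c.ξs m j) ≠ 0 := by
  intro h0
  obtain ⟨k, hk⟩ := sinh_eq_zero_iff.1 h0
  have hmem : c.ξs n i ∈ c.Xi n ∩ c.Xi m := by
    -- `ξs` counts down from ξ + sη while `Xi` counts up from ξ - sη, hence the complementary
    -- indices; the period k is charged to the second set.
    refine ⟨⟨c.twoS n - i, Nat.sub_le _ _, 0, ?_⟩, ⟨c.twoS m - j, Nat.sub_le _ _, k, ?_⟩⟩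
    · rw [Nat.cast_sub hi, ξs, spin]
      push_cast
      ring
    · rw [sub_eq_iff_eq_add] at hk
      rw [hk, Nat.cast_sub hj, ξs, spin]
      ring
  rw [hc n m hnm] at hmem
  exact hmem

theorem ξs_succ (n : Fin N) (k : ℕ) : c.ξs n (k + 1) = c.ξs n k - c.η := by
  simp only [ξs]
  push_cast
  ring

theorem ξs_sub_ξs (n : Fin N) (i j : ℕ) : c.ξs n i - c.ξs n j = (((j : ℤ) - i : ℤ) : ℂ) * c.η := by
  simp only [ξs]
  push_cast
  ring

theorem a_eq (l : ℂ) : c.a l = ∏ n, Complex.sinh (l - c.ξs n (c.twoS n)) := by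
  rw [a]
  refine Finset.prod_congr rfl fun n _ => ?_
  rw [ξs, spin]
  ring_nf

theorem d_eq (l : ℂ) : c.d l = ∏ n, Complex.sinh (l - c.ξs n 0) := by
  rw [d]
  refine Finset.prod_congr rfl fun n _ => ?_
  rw [ξs, spin]
  push_cast
  ring_nf

theorem a_ne_zero (hη : c.Generic) (hc : c.CondInh) {n : Fin N} {k : ℕ} (hk : k < c.twoS n) :
    c.a (c.ξs n k) ≠ 0 := by
  rw [a_eq, Finset.prod_ne_zero_iff]
  intro m _
  by_cases hm : n = m
  · subst hm
    rw [ξs_sub_ξs]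
    exact c.sinh_ne_zero_of_generic hη (by omega)
  · exact hc.sinh_ne_zero hm hk.le le_rfl

theorem d_ne_zero (hη : c.Generic) (hc : c.CondInh) {n : Fin N} {k : ℕ} (hk : k < c.twoS n) :
    c.d (c.ξs n (k + 1)) ≠ 0 := by
  rw [d_eq, Finset.prod_ne_zero_iff]
  intro m _
  by_cases hm : n = m
  · subst hm
    rw [ξs_sub_ξs]
    exact c.sinh_ne_zero_of_generic hη (by omega)
  · exact hc.sinh_ne_zero hm hk (Nat.zero_le _)

/-! ### Separate variables -/

theorem conf_induction {P : c.Conf → Prop} (h0 : P fun _ => 0)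
    (hs : ∀ (h : c.Conf) (n : Fin N) (j : Fin (c.twoS n + 1)), (j : ℕ) = h n + 1 → P h →
      P (Function.update h n j)) (h : c.Conf) : P h := by
  induction hk : ∑ n, (h n : ℕ) generalizing h with
  | zero =>
    have : h = fun _ => 0 := by
      funext n
      exact Fin.ext (Finset.sum_eq_zero_iff.1 hk n (Finset.mem_univ n))
    rwa [this]
  | succ k ih =>
    obtain ⟨n, -, hn⟩ := Finset.exists_ne_zero_of_sum_ne_zero (hk.trans_ne k.succ_ne_zero)
    set h' : c.Conf := Function.update h n ⟨(h n : ℕ) - 1, by omega⟩ with hh'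
    have e1 : h = Function.update h' n (h n) := by simp [hh']
    have e2 : (h n : ℕ) = h' n + 1 := by
      simp [hh']
      omega
    rw [e1]
    refine hs h' n (h n) e2 (ih h' ?_)
    have := c.sum_eq_add_one (h := h) (g := h') (fun m hm => by simp [hh', hm]) e2
    omega

/-- The usual argument for distinct eigenvalues, except that the operator separating two vectors may
depend on the pair. -/
theorem linearIndependent_of_joint_eigenvectors {E ι Λ : Type*} [AddCommGroup E] [Module ℂ E]
    {D : Λ → E →ₗ[ℂ] E} {e : ι → E} {f : ι → Λ → ℂ} (hf : ∀ i j, i ≠ j → ∃ l, f i l ≠ f j l)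
    (he : ∀ i, e i ≠ 0) (hD : ∀ i l, D l (e i) = f i l • e i) : LinearIndependent ℂ e := by
  classical
  rw [linearIndependent_iff']
  intro s
  induction s using Finset.induction_on with
  | empty => simp
  | insert a s ha ih =>
    intro g hg
    rw [Finset.sum_insert ha] at hg
    have hs : ∀ i ∈ s, g i = 0 := by
      intro j hj
      obtain ⟨l, hl⟩ := hf j a fun h => ha (h ▸ hj)
      have h1 := congrArg (D l) hg
      have h2 := congrArg (fun v => f a l • v) hg
      simp only [map_add, map_sum, map_smul, hD, smul_add, Finset.smul_sum, smul_smul, map_zero,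
        smul_zero] at h1 h2
      have h3 := ih (fun i => g i * (f i l - f a l)) (by
        rw [← sub_eq_zero] at h1 h2
        have := sub_eq_zero.2 (h1.trans h2.symm)
        simp only [sub_zero] at this
        rw [mul_comm (f a l) (g a), add_sub_add_left_eq_sub, ← Finset.sum_sub_distrib] at this
        rw [← this]
        refine Finset.sum_congr rfl fun i _ => ?_
        rw [← sub_smul]
        congr 1
        ring) j hj
      exact (mul_eq_zero.1 h3).resolve_right (sub_ne_zero.2 hl)
    intro i hi
    rcases Finset.mem_insert.1 hi with rfl | hi
    · rw [Finset.sum_eq_zero fun j hj => by rw [hs j hj, zero_smul], add_zero] at hg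
      exact (smul_eq_zero.1 hg).resolve_right (he _)
    · exact hs i hi

/-- The eigenvalue of `D(λ)` on the separate state labelled by `h`. -/
def eig (h : c.Conf) (l : ℂ) : ℂ := ∏ n, Complex.sinh (l - c.ξs n (h n))

theorem eig_eq (h : c.Conf) (n : Fin N) (l : ℂ) : c.eig h l =
    Complex.sinh (l - c.ξs n (h n)) *
      ∏ m ∈ Finset.univ.erase n, Complex.sinh (l - c.ξs m (h m)) :=
  (Finset.mul_prod_erase _ _ (Finset.mem_univ n)).symm

theorem eig_self (h : c.Conf) (n : Fin N) : c.eig h (c.ξs n (h n)) = 0 := by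
  rw [eig_eq c h n]
  simp

theorem prod_erase_ne_zero (hc : c.CondInh) (h : c.Conf) (n : Fin N) {k : ℕ}
    (hk : k ≤ c.twoS n) :
    ∏ m ∈ Finset.univ.erase n, Complex.sinh (c.ξs n k - c.ξs m (h m)) ≠ 0 :=
  Finset.prod_ne_zero_iff.2 fun m hm =>
    hc.sinh_ne_zero (Finset.ne_of_mem_erase hm).symm hk (Nat.le_of_lt_succ (h m).2)

/-- At λ = ξₙ^(kₙ) the eigenvalue labelled by k vanishes and the other product does not. The integer
j may lie outside 0, …, 2sₙ, which is what excludes states beyond the ends of the ladder. -/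
theorem exists_eig_ne (hη : c.Generic) (hc : c.CondInh) (k h : c.Conf) (n : Fin N) {z : ℂ}
    {j : ℤ} (hz : z = c.ξs n 0 - j * c.η) (hj : j ≠ (k n : ℕ)) :
    ∃ l, Complex.sinh (l - z) * ∏ m ∈ Finset.univ.erase n, Complex.sinh (l - c.ξs m (h m)) ≠
      c.eig k l := by
  refine ⟨c.ξs n (k n), ?_⟩
  rw [eig_self]
  refine mul_ne_zero ?_ (c.prod_erase_ne_zero hc h n (Nat.le_of_lt_succ (k n).2))
  have : c.ξs n (k n) - z = ((j - (k n : ℕ) : ℤ) : ℂ) * c.η := by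
    rw [hz, ξs, ξs]
    push_cast
    ring
  rw [this]
  exact c.sinh_ne_zero_of_generic hη (sub_ne_zero.2 hj)

/-- The states `e h` are generated from an eigenvector `e 0` of the operators `D(λ)` by the raising
operators `X(ξₙ^(k))`; the operators `Y(λ)` are the lowering operators. -/
structure IsSeparate (X Y D : ℂ → c.States →ₗ[ℂ] c.States) (γ : Fin N → ℕ → ℂ)
    (e : c.Conf → c.States) : Prop where
  D_X : ∀ l m v, D m v = 0 →
    Complex.sinh (l - m) • D l (X m v) = Complex.sinh (l - m + c.η) • X m (D l v)
  D_Y : ∀ l m v, D m v = 0 →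
    Complex.sinh (l - m) • D l (Y m v) = Complex.sinh (l - m - c.η) • Y m (D l v)
  Y_X : ∀ l v, D l v = 0 → Y (l - c.η) (X l v) = -(c.a l * c.d (l - c.η)) • v
  cont : ∀ v, Continuous fun l => D l v
  D_zero : ∀ l, D l (e fun _ => 0) = c.d l • e fun _ => 0
  e_zero : (e fun _ => 0) ≠ 0
  γ_ne : ∀ n k, k < c.twoS n → γ n k ≠ 0
  e_succ : ∀ (h : c.Conf) (n : Fin N) (j : Fin (c.twoS n + 1)), (j : ℕ) = h n + 1 →
    e (Function.update h n j) = γ n (h n) • X (c.ξs n (h n)) (e h)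

namespace IsSeparate

variable {c} {X Y D : ℂ → c.States →ₗ[ℂ] c.States} {γ : Fin N → ℕ → ℂ} {e : c.Conf → c.States}

/-- The factor sinh(λ - ξₙ^(hₙ)) is contained in the eigenvalue on `v`, so it cancels and is
replaced by the shifted one. The choice z = η moves the node to label hₙ + 1, and z = -η to label hₙ
- 1. -/
theorem D_exchange (hD : ∀ v, Continuous fun l => D l v) {Z : c.States →ₗ[ℂ] c.States} {z : ℂ}
    {h : c.Conf} {n : Fin N} {v : c.States}
    (hZ : ∀ l, Complex.sinh (l - c.ξs n (h n)) • D l (Z v) =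
      Complex.sinh (l - c.ξs n (h n) + z) • Z (D l v))
    (hv : ∀ l, D l v = c.eig h l • v) (l : ℂ) :
    D l (Z v) = (Complex.sinh (l - (c.ξs n (h n) - z)) *
      ∏ m ∈ Finset.univ.erase n, Complex.sinh (l - c.ξs m (h m))) • Z v := by
  refine eq_of_sinh_smul_eq (c.ξs n (h n)) (f := fun l => D l (Z v)) (g := fun l =>
    (Complex.sinh (l - (c.ξs n (h n) - z)) *
      ∏ m ∈ Finset.univ.erase n, Complex.sinh (l - c.ξs m (h m))) • Z v) (hD _) ?_ ?_ l
  · fun_prop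
  · intro l
    rw [hZ, hv, map_smul, smul_smul, smul_smul, c.eig_eq h n, sub_sub_eq_add_sub,
      sub_add_eq_add_sub]
    congr 1
    ring

theorem D_e (hS : c.IsSeparate X Y D γ e) (h : c.Conf) (l : ℂ) :
    D l (e h) = c.eig h l • e h := by
  revert l
  refine c.conf_induction (P := fun h => ∀ l, D l (e h) = c.eig h l • e h) ?_ ?_ h
  · intro l
    rw [hS.D_zero, d_eq, eig]
    rfl
  · intro h n j hj hh l
    rw [hS.e_succ h n j hj, map_smul, D_exchange hS.cont
      (fun l => hS.D_X l _ _ (by rw [hh, c.eig_self, zero_smul])) hh, smul_comm,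
      c.eig_eq (Function.update h n j) n, Function.update_self, hj, ξs_succ]
    congr 2
    refine Finset.prod_congr rfl fun m hm => ?_
    rw [Function.update_of_ne (Finset.ne_of_mem_erase hm)]

theorem D_e_self (hS : c.IsSeparate X Y D γ e) (h : c.Conf) (n : Fin N) :
    D (c.ξs n (h n)) (e h) = 0 := by
  rw [hS.D_e, eig_self, zero_smul]

theorem Y_e_succ (hS : c.IsSeparate X Y D γ e) (h : c.Conf) (n : Fin N)
    (j : Fin (c.twoS n + 1)) (hj : (j : ℕ) = h n + 1) :
    Y (c.ξs n j) (e (Function.update h n j)) =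
      -(γ n (h n) * (c.a (c.ξs n (h n)) * c.d (c.ξs n j))) • e h := by
  rw [hS.e_succ h n j hj, map_smul, hj, ξs_succ, hS.Y_X _ _ (hS.D_e_self h n), smul_smul, mul_neg]

/-- The quantum determinant lets Y bring a raised state back to a nonzero multiple of its
predecessor, so nonvanishing propagates upwards from the reference state. -/
theorem e_ne_zero (hS : c.IsSeparate X Y D γ e) (hη : c.Generic) (hc : c.CondInh) (h : c.Conf) :
    e h ≠ 0 := by
  refine c.conf_induction (P := fun h => e h ≠ 0) hS.e_zero
    (fun h n j hj hh h0 => hh ?_) h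
  have := hS.Y_e_succ h n j hj
  have hlt : (h n : ℕ) < c.twoS n := by omega
  rw [h0, map_zero, hj] at this
  exact (smul_eq_zero.1 this.symm).resolve_left (neg_ne_zero.2 (mul_ne_zero (hS.γ_ne _ _ hlt)
    (mul_ne_zero (c.a_ne_zero hη hc hlt) (c.d_ne_zero hη hc hlt))))

theorem exists_eig_ne_eig (hη : c.Generic) (hc : c.CondInh) {h k : c.Conf} (hk : h ≠ k) :
    ∃ l, c.eig h l ≠ c.eig k l := by
  obtain ⟨n, hn⟩ := Function.ne_iff.1 hk
  obtain ⟨l, hl⟩ := c.exists_eig_ne hη hc k h n (z := c.ξs n (h n)) (j := (h n : ℕ))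
    (by simp only [ξs]; push_cast; ring) (fun h' => hn (Fin.ext (by exact_mod_cast h')))
  exact ⟨l, by rwa [c.eig_eq h n]⟩

theorem linearIndependent (hS : c.IsSeparate X Y D γ e) (hη : c.Generic) (hc : c.CondInh) :
    LinearIndependent ℂ e :=
  linearIndependent_of_joint_eigenvectors (fun _ _ => exists_eig_ne_eig hη hc)
    (hS.e_ne_zero hη hc) hS.D_e

/-- Otherwise u could be adjoined to the states `e h`, giving more independent vectors than the
dimension allows. -/
theorem eq_zero_of_eigenvector (hS : c.IsSeparate X Y D γ e) (hη : c.Generic) (hc : c.CondInh)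
    {u : c.States} {f : ℂ → ℂ} (hu : ∀ l, D l u = f l • u) (hf : ∀ k, ∃ l, f l ≠ c.eig k l) :
    u = 0 := by
  by_contra hu0
  have hli : LinearIndependent ℂ (fun o : Option c.Conf => o.elim u e) := by
    refine linearIndependent_of_joint_eigenvectors (D := D) (f := fun o => o.elim f c.eig) ?_ ?_ ?_
    · rintro (_ | h) (_ | k) hne
      · exact absurd rfl hne
      · exact hf k
      · obtain ⟨l, hl⟩ := hf h
        exact ⟨l, hl.symm⟩
      · exact exists_eig_ne_eig hη hc fun h' => hne (congrArg some h')
    · rintro (_ | h)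
      · exact hu0
      · exact hS.e_ne_zero hη hc h
    · rintro (_ | h) l
      · exact hu l
      · exact hS.D_e h l
  have := hli.fintype_card_le_finrank
  rw [Fintype.card_option, Module.finrank_fintype_fun_eq_card] at this
  omega

/-- The result would be a joint eigenvector carrying the node ξₙ^(2sₙ+1), which belongs to no label.
The lower end is treated in the same way with label -1. -/
theorem X_e_top (hS : c.IsSeparate X Y D γ e) (hη : c.Generic) (hc : c.CondInh) {h : c.Conf}
    {n : Fin N} (hn : (h n : ℕ) = c.twoS n) : X (c.ξs n (h n)) (e h) = 0 := by
  refine hS.eq_zero_of_eigenvector hη hc (D_exchange hS.cont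
    (fun l => hS.D_X l _ _ (hS.D_e_self h n)) (hS.D_e h)) fun k =>
    c.exists_eig_ne hη hc k h n (j := (h n : ℕ) + 1) ?_ (by omega)
  simp only [ξs]
  push_cast
  ring

theorem Y_e_bot (hS : c.IsSeparate X Y D γ e) (hη : c.Generic) (hc : c.CondInh) {h : c.Conf}
    {n : Fin N} (hn : (h n : ℕ) = 0) : Y (c.ξs n (h n)) (e h) = 0 := by
  refine hS.eq_zero_of_eigenvector hη hc (D_exchange hS.cont (z := -c.η)
    (fun l => by rw [← sub_eq_add_neg]; exact hS.D_Y l _ _ (hS.D_e_self h n)) (hS.D_e h)) fun k =>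
    c.exists_eig_ne hη hc k h n (j := (h n : ℕ) - 1) ?_ (by omega)
  simp only [ξs]
  push_cast
  ring

theorem X_e (hS : c.IsSeparate X Y D γ e) (hη : c.Generic) (hc : c.CondInh) (h : c.Conf)
    (n : Fin N) : X (c.ξs n (h n)) (e h) = ∑ j : Fin (c.twoS n + 1),
      (if (j : ℕ) = h n + 1 then (γ n (h n))⁻¹ else 0) • e (Function.update h n j) := by
  rcases eq_or_ne (h n : ℕ) (c.twoS n) with hn | hn
  · rw [hS.X_e_top hη hc hn, Finset.sum_eq_zero]
    intro j _
    rw [if_neg (by omega), zero_smul]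
  · have hlt : (h n : ℕ) < c.twoS n := by omega
    rw [Finset.sum_eq_single ⟨(h n : ℕ) + 1, by omega⟩]
    · rw [if_pos rfl, hS.e_succ h n _ rfl, smul_smul, inv_mul_cancel₀ (hS.γ_ne _ _ hlt), one_smul]
    · intro j _ hj
      rw [if_neg fun hj' => hj (Fin.ext hj'), zero_smul]
    · simp

theorem Y_e (hS : c.IsSeparate X Y D γ e) (hη : c.Generic) (hc : c.CondInh) (h : c.Conf)
    (n : Fin N) : Y (c.ξs n (h n)) (e h) = ∑ j : Fin (c.twoS n + 1),
      (if (h n : ℕ) = j + 1 then -(γ n j * (c.a (c.ξs n j) * c.d (c.ξs n (h n)))) else 0) •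
        e (Function.update h n j) := by
  rcases eq_or_ne (h n : ℕ) 0 with hn | hn
  · rw [hS.Y_e_bot hη hc hn, Finset.sum_eq_zero]
    intro j _
    rw [if_neg (by omega), zero_smul]
  · have hlt : (h n : ℕ) - 1 + 1 = h n := by omega
    rw [Finset.sum_eq_single ⟨(h n : ℕ) - 1, by omega⟩]
    · rw [if_pos hlt.symm]
      have := hS.Y_e_succ (Function.update h n ⟨(h n : ℕ) - 1, by omega⟩) n (h n) (by simp; omega)
      simpa using this
    · intro j _ hj
      rw [if_neg fun hj' => hj (Fin.ext (by simp; omega)), zero_smul]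
    · simp

end IsSeparate

/-! ### Vandermonde factors -/

/-- Isolates the factors that involve x n, at the price of a sign that does not depend on the values
of x. -/
theorem prod_prod_Iio_eq (x : Fin N → ℂ) (n : Fin N) :
    ∏ j, ∏ i ∈ Finset.Iio j, Complex.sinh (x j - x i) =
      (∏ j ∈ Finset.univ.erase n, ∏ i ∈ Finset.univ.erase n,
        if i < j then Complex.sinh (x j - x i) else 1) *
      ((∏ m ∈ Finset.univ.erase n, if n < m then (-1 : ℂ) else 1) *
        ∏ m ∈ Finset.univ.erase n, Complex.sinh (x n - x m)) := by
  set f : Fin N → Fin N → ℂ := fun j i => if i < j then Complex.sinh (x j - x i) else 1 with hf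
  have h1 : ∀ j, ∏ i ∈ Finset.Iio j, Complex.sinh (x j - x i) = ∏ i, f j i := by
    intro j
    rw [hf, ← Finset.prod_filter]
    congr 1
    ext i
    simp
  have h2 : ∀ j, ∏ i, f j i = f j n * ∏ i ∈ Finset.univ.erase n, f j i := fun j =>
    (Finset.mul_prod_erase _ _ (Finset.mem_univ n)).symm
  simp only [h1]
  rw [← Finset.mul_prod_erase _ _ (Finset.mem_univ n), h2 n]
  simp only [h2]
  have h3 : (∏ m ∈ Finset.univ.erase n, f n m) * ∏ m ∈ Finset.univ.erase n, f m n =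
      (∏ m ∈ Finset.univ.erase n, if n < m then (-1 : ℂ) else 1) *
        ∏ m ∈ Finset.univ.erase n, Complex.sinh (x n - x m) := by
    rw [← Finset.prod_mul_distrib, ← Finset.prod_mul_distrib]
    refine Finset.prod_congr rfl fun m hm => ?_
    rcases lt_or_gt_of_ne (Finset.ne_of_mem_erase hm) with h | h
    · simp [hf, h, h.not_gt]
    · simp [hf, h, h.not_gt, ← Complex.sinh_neg]
  rw [Finset.prod_mul_distrib, show f n n = 1 by simp [hf], one_mul, ← h3]
  ring

theorem vdm_update (h : c.Conf) (n : Fin N) (j : Fin (c.twoS n + 1)) :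
    c.vdm (Function.update h n j) *
        ∏ m ∈ Finset.univ.erase n, Complex.sinh (c.ξs n (h n) - c.ξs m (h m)) =
      c.vdm h * ∏ m ∈ Finset.univ.erase n, Complex.sinh (c.ξs n j - c.ξs m (h m)) := by
  have hu : ∀ m ∈ Finset.univ.erase n, c.ξs m (Function.update h n j m) = c.ξs m (h m) :=
    fun m hm => by rw [Function.update_of_ne (Finset.ne_of_mem_erase hm)]
  simp only [vdm]
  rw [prod_prod_Iio_eq (fun m => c.ξs m (h m)) n,
    prod_prod_Iio_eq (fun m => c.ξs m (Function.update h n j m)) n, Function.update_self]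
  have e1 : ∏ m ∈ Finset.univ.erase n, Complex.sinh (c.ξs n j - c.ξs m (Function.update h n j m)) =
      ∏ m ∈ Finset.univ.erase n, Complex.sinh (c.ξs n j - c.ξs m (h m)) :=
    Finset.prod_congr rfl fun m hm => by rw [hu m hm]
  have e2 : (∏ j' ∈ Finset.univ.erase n, ∏ i ∈ Finset.univ.erase n,
      if i < j' then Complex.sinh (c.ξs j' (Function.update h n j j') -
        c.ξs i (Function.update h n j i)) else 1) =
      ∏ j' ∈ Finset.univ.erase n, ∏ i ∈ Finset.univ.erase n,
        if i < j' then Complex.sinh (c.ξs j' (h j') - c.ξs i (h i)) else 1 :=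
    Finset.prod_congr rfl fun m hm => Finset.prod_congr rfl fun i hi => by rw [hu m hm, hu i hi]
  rw [e1, e2]
  ring

theorem vdm_ne_zero (hc : c.CondInh) (h : c.Conf) : c.vdm h ≠ 0 := by
  refine Finset.prod_ne_zero_iff.2 fun j _ => Finset.prod_ne_zero_iff.2 fun i hi => ?_
  exact hc.sinh_ne_zero (Finset.mem_Iio.1 hi).ne' (Nat.le_of_lt_succ (h j).2)
    (Nat.le_of_lt_succ (h i).2)

/-- The interpolation nodes attached to a label. -/
def nodes (h : c.Conf) (n : Fin N) : ℂ := c.ξs n (h n)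

theorem nodes_ne (hc : c.CondInh) (h : c.Conf) (i j : Fin N) (hij : i ≠ j) :
    Complex.sinh (c.nodes h i - c.nodes h j) ≠ 0 :=
  hc.sinh_ne_zero hij (Nat.le_of_lt_succ (h i).2) (Nat.le_of_lt_succ (h j).2)

/-- The denominator of the n-th Lagrange function is, up to sign, the part of the Vandermonde factor
that depends on hₙ, and the numerator does not involve hₙ. Hence this weight makes the interpolated
action factorize over the sites. -/
theorem vdm_mul_lagrange_update (hc : c.CondInh) (h : c.Conf) (n : Fin N)
    (j : Fin (c.twoS n + 1)) (l : ℂ) :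
    c.vdm (Function.update h n j) * lagrange (c.nodes (Function.update h n j)) n l =
      c.vdm h * lagrange (c.nodes h) n l := by
  have hnum : ∏ m ∈ Finset.univ.erase n, Complex.sinh (l - c.nodes (Function.update h n j) m) =
      ∏ m ∈ Finset.univ.erase n, Complex.sinh (l - c.nodes h m) :=
    Finset.prod_congr rfl fun m hm => by
      rw [nodes, nodes, Function.update_of_ne (Finset.ne_of_mem_erase hm)]
  have hden : ∏ m ∈ Finset.univ.erase n,
        Complex.sinh (c.nodes (Function.update h n j) n - c.nodes (Function.update h n j) m) =
      ∏ m ∈ Finset.univ.erase n, Complex.sinh (c.ξs n j - c.ξs m (h m)) :=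
    Finset.prod_congr rfl fun m hm => by
      rw [nodes, nodes, Function.update_of_ne (Finset.ne_of_mem_erase hm), Function.update_self]
  have h1 := c.prod_erase_ne_zero hc h n (Nat.le_of_lt_succ (h n).2)
  have h2 := c.prod_erase_ne_zero hc h n (Nat.le_of_lt_succ j.2)
  have h3 := c.vdm_update h n j
  rw [lagrange, lagrange, Finset.prod_div_distrib, Finset.prod_div_distrib, hnum, hden]
  simp only [nodes] at *
  rw [mul_div_assoc', mul_div_assoc', div_eq_div_iff h2 h1]
  linear_combination (∏ m ∈ Finset.univ.erase n, Complex.sinh (l - c.ξs m (h m))) * h3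

/-! ### Transfer matrices in a basis of separate states -/

/-- `T(λ)` acts tridiagonally, up to interpolation, on the linearly independent states `e h`. -/
structure IsSeparateTransfer (T : ℂ → c.States →ₗ[ℂ] c.States) (r : ℂ)
    (A : (n : Fin N) → Matrix (Fin (c.twoS n + 1)) (Fin (c.twoS n + 1)) ℂ)
    (e : c.Conf → c.States) : Prop where
  linearIndependent : LinearIndependent ℂ e
  interpolation : ∀ x : Fin N → ℂ, (∀ i j, i ≠ j → Complex.sinh (x i - x j) ≠ 0) →
    ∀ l v, T l v = ∑ n, lagrange x n l • T (x n) v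
  action : ∀ (h : c.Conf) (n : Fin N), T (c.ξs n (h n)) (e h) =
    ∑ j : Fin (c.twoS n + 1), (r ^ (h n : ℕ) * r⁻¹ ^ (j : ℕ) * A n (h n) j) • e (Function.update h n j)

/-- The matrix `t(ξₙ^(i)) δᵢⱼ - Aᵢⱼ`. -/
def baxter (A : (n : Fin N) → Matrix (Fin (c.twoS n + 1)) (Fin (c.twoS n + 1)) ℂ) (t : ℂ → ℂ)
    (n : Fin N) : Matrix (Fin (c.twoS n + 1)) (Fin (c.twoS n + 1)) ℂ :=
  Matrix.diagonal (fun i : Fin (c.twoS n + 1) => t (c.ξs n i)) - A n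

/-- The state `∑_h ∏ₙ r^{-hₙ} pₙ(hₙ) ∏_{i<j} sinh (ξⱼ^(hⱼ) - ξᵢ^(hᵢ)) e_h`. -/
def separateState (r : ℂ) (e : c.Conf → c.States) (p : (n : Fin N) → Fin (c.twoS n + 1) → ℂ) :
    c.States :=
  ∑ h : c.Conf, ((∏ n, r⁻¹ ^ (h n : ℕ) * p n (h n)) * c.vdm h) • e h

namespace IsSeparateTransfer

variable {c} {T : ℂ → c.States →ₗ[ℂ] c.States} {r : ℂ}
  {A : (n : Fin N) → Matrix (Fin (c.twoS n + 1)) (Fin (c.twoS n + 1)) ℂ} {e : c.Conf → c.States}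

/-- The map (h, j) ↦ (h with hₙ replaced by j, hₙ) is an involution. -/
theorem sum_update_comm {E : Type*} [AddCommMonoid E] (n : Fin N)
    (F : c.Conf → Fin (c.twoS n + 1) → E) :
    ∑ h : c.Conf, ∑ j, F h j = ∑ k : c.Conf, ∑ i, F (Function.update k n i) (k n) := by
  rw [← Fintype.sum_prod_type', ← Fintype.sum_prod_type']
  refine Finset.sum_nbij' (fun x => (Function.update x.1 n x.2, x.1 n))
    (fun x => (Function.update x.1 n x.2, x.1 n)) ?_ ?_ ?_ ?_ ?_ <;> simp

/-- Exchanging the old and the new value of hₙ turns the hopping sum at site n into the n-th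
null-vector equation, which produces t(ξₙ^(kₙ)). Summing over n then interpolates t at the nodes of
k. -/
theorem apply_separateState (hT : c.IsSeparateTransfer T r A e) (hc : c.CondInh) (hr : r ≠ 0)
    {t : ℂ → ℂ} (ht : IsTrig N t) {p : (n : Fin N) → Fin (c.twoS n + 1) → ℂ}
    (hp : ∀ n, Matrix.vecMul (p n) (c.baxter A t n) = 0) (l : ℂ) :
    T l (c.separateState r e p) = t l • c.separateState r e p := by
  set P : c.Conf → ℂ := fun h => ∏ n, r⁻¹ ^ (h n : ℕ) * p n (h n) with hP
  have hp' : ∀ n (k : Fin (c.twoS n + 1)), ∑ i, p n i * A n i k = t (c.ξs n k) * p n k := by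
    intro n k
    have := congrFun (hp n) k
    rw [baxter, Matrix.vecMul_sub, Pi.sub_apply, Matrix.vecMul_diagonal, Pi.zero_apply,
      sub_eq_zero] at this
    rw [mul_comm, this]
    rfl
  have hPsum : ∀ n (k : c.Conf), ∑ i, P (Function.update k n i) *
      (r ^ (i : ℕ) * r⁻¹ ^ (k n : ℕ) * A n i (k n)) = t (c.ξs n (k n)) * P k := by
    intro n k
    have h1 : ∀ i, P (Function.update k n i) = r⁻¹ ^ (i : ℕ) * p n i *
        ∏ m ∈ Finset.univ.erase n, r⁻¹ ^ (k m : ℕ) * p m (k m) := by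
      intro i
      rw [hP]
      simp only
      rw [← Finset.mul_prod_erase _ _ (Finset.mem_univ n), Function.update_self]
      congr 1
      exact Finset.prod_congr rfl fun m hm => by
        rw [Function.update_of_ne (Finset.ne_of_mem_erase hm)]
    have h2 := h1 (k n)
    rw [Function.update_eq_self] at h2
    rw [h2]
    simp only [h1]
    have h3 : ∀ i : Fin (c.twoS n + 1), r⁻¹ ^ (i : ℕ) * r ^ (i : ℕ) = 1 := fun i => by
      rw [← mul_pow, inv_mul_cancel₀ hr, one_pow]
    calc _ = ∑ i, (p n i * A n i (k n)) * (r⁻¹ ^ (k n : ℕ) *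
          ∏ m ∈ Finset.univ.erase n, r⁻¹ ^ (k m : ℕ) * p m (k m)) :=
          Finset.sum_congr rfl fun i _ => by
            linear_combination (p n i * A n i (k n) * (r⁻¹ ^ (k n : ℕ) *
              ∏ m ∈ Finset.univ.erase n, r⁻¹ ^ (k m : ℕ) * p m (k m))) * h3 i
      _ = _ := by
          rw [← Finset.sum_mul, hp']
          ring
  -- The nodes are chosen according to h, so that at each of them the action on `e h` is known.
  have hTe : ∀ h, T l (e h) = ∑ n, ∑ j : Fin (c.twoS n + 1), (lagrange (c.nodes h) n l *
      (r ^ (h n : ℕ) * r⁻¹ ^ (j : ℕ) * A n (h n) j)) • e (Function.update h n j) := by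
    intro h
    rw [hT.interpolation _ (c.nodes_ne hc h)]
    refine Finset.sum_congr rfl fun n _ => ?_
    rw [nodes, hT.action, Finset.smul_sum]
    simp only [smul_smul]
  calc T l (c.separateState r e p)
      = ∑ n, ∑ h : c.Conf, ∑ j : Fin (c.twoS n + 1), (P h * c.vdm h * (lagrange (c.nodes h) n l *
          (r ^ (h n : ℕ) * r⁻¹ ^ (j : ℕ) * A n (h n) j))) • e (Function.update h n j) := by
        rw [separateState, map_sum, Finset.sum_comm]
        refine Finset.sum_congr rfl fun h _ => ?_
        rw [map_smul, hTe, Finset.smul_sum]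
        simp only [Finset.smul_sum, smul_smul]
        rfl
    _ = ∑ n, ∑ k : c.Conf, (t (c.nodes k n) * lagrange (c.nodes k) n l * (P k * c.vdm k)) • e k := by
        refine Finset.sum_congr rfl fun n _ => ?_
        rw [sum_update_comm]
        refine Finset.sum_congr rfl fun k _ => ?_
        simp only [Function.update_idem, Function.update_eq_self, Function.update_self]
        rw [← Finset.sum_smul]
        congr 1
        calc _ = ∑ i, (P (Function.update k n i) *
                (r ^ (i : ℕ) * r⁻¹ ^ (k n : ℕ) * A n i (k n))) *
                (c.vdm k * lagrange (c.nodes k) n l) :=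
              Finset.sum_congr rfl fun i _ => by
                -- The weight times the Lagrange function is the same for every i, so it leaves the
                -- sum over i.
                rw [← c.vdm_mul_lagrange_update hc k n i]
                ring
          _ = _ := by
              rw [← Finset.sum_mul, hPsum, nodes]
              ring
    _ = t l • c.separateState r e p := by
        rw [Finset.sum_comm, separateState, Finset.smul_sum]
        refine Finset.sum_congr rfl fun k _ => ?_
        rw [← Finset.sum_smul, ← Finset.sum_mul, smul_smul,
          ht.eq_interpolation (c.nodes_ne hc k) l]
        simp only [mul_comm (t _)]
        rfl

theorem separateState_ne_zero (hT : c.IsSeparateTransfer T r A e) (hc : c.CondInh) (hr : r ≠ 0)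
    {p : (n : Fin N) → Fin (c.twoS n + 1) → ℂ} (hp : ∀ n, p n ≠ 0) :
    c.separateState r e p ≠ 0 := by
  intro h0
  choose h hh using fun n => Function.ne_iff.1 (hp n)
  have := Fintype.linearIndependent_iff.1 hT.linearIndependent _ h0 h
  refine mul_ne_zero (Finset.prod_ne_zero_iff.2 fun n _ => mul_ne_zero ?_ (hh n))
    (c.vdm_ne_zero hc h) this
  exact pow_ne_zero _ (inv_ne_zero hr)

/-- Row i is the eigenvalue equation at λ = ξₙ^(i), tested on the state with hₙ = i; the powers of r
absorb the twist. -/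
theorem baxter_mulVec (hT : c.IsSeparateTransfer T r A e) (hr : r ≠ 0) {t : ℂ → ℂ}
    {w : c.States →ₗ[ℂ] ℂ} (hw : ∀ l v, w (T l v) = t l * w v) (h : c.Conf) (n : Fin N) :
    (c.baxter A t n).mulVec (fun j => r⁻¹ ^ (j : ℕ) * w (e (Function.update h n j))) = 0 := by
  funext i
  have h1 := hw (c.ξs n i) (e (Function.update h n i))
  have h2 := hT.action (Function.update h n i) n
  rw [Function.update_self] at h2
  rw [h2, map_sum] at h1
  simp only [map_smul, smul_eq_mul, Function.update_idem] at h1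
  have h3 : r⁻¹ ^ (i : ℕ) * r ^ (i : ℕ) = 1 := by rw [← mul_pow, inv_mul_cancel₀ hr, one_pow]
  rw [baxter, Matrix.sub_mulVec, Pi.sub_apply, Matrix.mulVec_diagonal, Pi.zero_apply, sub_eq_zero,
    mul_left_comm, ← h1, Finset.mul_sum]
  refine Finset.sum_congr rfl fun j _ => ?_
  linear_combination (r⁻¹ ^ (j : ℕ) * A n i j * w (e (Function.update h n j))) * h3

end IsSeparateTransfer

/-! ### Hessenberg matrices -/

/-- Row k - 1 expresses q k through the earlier entries, because the superdiagonal does not vanish;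
a null vector is therefore fixed by q 0. -/
theorem eq_zero_of_hessenberg {d : ℕ} {H : Matrix (Fin (d + 1)) (Fin (d + 1)) ℂ}
    (h0 : ∀ i j : Fin (d + 1), (i : ℕ) + 1 < j → H i j = 0)
    (h1 : ∀ i j : Fin (d + 1), (j : ℕ) = i + 1 → H i j ≠ 0) {q : Fin (d + 1) → ℂ}
    (hq : H.mulVec q = 0) (hq0 : q 0 = 0) : q = 0 := by
  have key : ∀ k : ℕ, ∀ j : Fin (d + 1), (j : ℕ) = k → q j = 0 := by
    intro k
    induction k using Nat.strong_induction_on with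
    | _ k ih =>
      intro j hj
      rcases Nat.eq_zero_or_pos k with rfl | hk
      · rwa [show j = 0 from Fin.ext hj]
      · set i : Fin (d + 1) := ⟨k - 1, by omega⟩ with hi
        have hij : (j : ℕ) = i + 1 := by
          simp [hi]
          omega
        have := congrFun hq i
        rw [Matrix.mulVec, dotProduct, Finset.sum_eq_single j] at this
        · exact (mul_eq_zero.1 this).resolve_left (h1 i j hij)
        · intro m _ hm
          rcases lt_or_ge (m : ℕ) k with h | h
          · rw [ih m h m rfl, mul_zero]
          · have : (m : ℕ) ≠ j := fun h' => hm (Fin.ext h')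
            rw [h0 i m (by omega), zero_mul]
        · simp
  funext j
  exact key j j rfl

theorem finrank_ker_of_hessenberg {d : ℕ} {H : Matrix (Fin (d + 1)) (Fin (d + 1)) ℂ}
    (h0 : ∀ i j : Fin (d + 1), (i : ℕ) + 1 < j → H i j = 0)
    (h1 : ∀ i j : Fin (d + 1), (j : ℕ) = i + 1 → H i j ≠ 0) (hdet : H.det = 0) :
    Module.finrank ℂ (LinearMap.ker H.mulVecLin) = 1 := by
  apply le_antisymm
  · have hinj : Function.Injective
        ((LinearMap.proj (R := ℂ) (φ := fun _ : Fin (d + 1) => ℂ) 0).comp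
          (LinearMap.ker H.mulVecLin).subtype) := by
      rw [← LinearMap.ker_eq_bot, LinearMap.ker_eq_bot']
      intro q hq
      exact Subtype.ext (eq_zero_of_hessenberg h0 h1 q.2 hq)
    simpa using LinearMap.finrank_le_finrank_of_injective hinj
  · obtain ⟨q, hq, hHq⟩ := Matrix.exists_mulVec_eq_zero_iff.2 hdet
    rw [Nat.one_le_iff_ne_zero, ← Nat.pos_iff_ne_zero, Module.finrank_pos_iff]
    exact ⟨⟨q, hHq⟩, 0, fun h => hq (congrArg Subtype.val h)⟩

/-! ### The separate states -/

/-- An extra factor inserted at position a commutes with the factors behind it and can be moved to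
the end; this is how one more raising operator is split off. -/
theorem prod_ofFn_eq_mul {R : Type*} [Monoid R] {n : ℕ} {f g : Fin n → R} {y : R} (a : Fin n)
    (hg : ∀ i, i ≠ a → g i = f i) (ha : g a = f a * y) (hy : ∀ i, Commute y (f i)) :
    (List.ofFn g).prod = (List.ofFn f).prod * y := by
  induction n with
  | zero => exact a.elim0
  | succ n ih =>
    rw [List.ofFn_succ, List.ofFn_succ, List.prod_cons, List.prod_cons]
    have hc : Commute y (List.ofFn fun i : Fin n => f i.succ).prod := by
      refine Commute.list_prod_right _ _ fun z hz => ?_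
      obtain ⟨i, rfl⟩ := (List.mem_ofFn' _ _).1 hz
      exact hy _
    induction a using Fin.cases with
    | zero =>
      rw [ha, show (fun i : Fin n => g i.succ) = fun i => f i.succ from
        funext fun i => hg _ (Fin.succ_ne_zero i), mul_assoc, hc.eq, ← mul_assoc]
    | succ a =>
      rw [hg 0 (Fin.succ_ne_zero a).symm, mul_assoc, ih a
        (fun i hi => hg _ fun h => hi (Fin.succ_injective _ h)) ha fun i => hy _]

/-- The product `∏ₙ ∏_{k < hₙ} Z n k`, in increasing order of `n` and `k`. -/
def orderedProd (Z : Fin N → ℕ → c.Op) (h : c.Conf) : c.Op :=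
  (List.ofFn fun n : Fin N => (List.ofFn fun k : Fin (h n : ℕ) => Z n k).prod).prod

theorem orderedProd_zero (Z : Fin N → ℕ → c.Op) : c.orderedProd Z (fun _ => 0) = 1 := by
  rw [orderedProd]
  refine List.prod_eq_one fun x hx => ?_
  obtain ⟨i, rfl⟩ := (List.mem_ofFn' _ _).1 hx
  simp

theorem orderedProd_update {Z : Fin N → ℕ → c.Op} (hZ : ∀ n k m j, Commute (Z n k) (Z m j))
    (h : c.Conf) (n : Fin N) (j : Fin (c.twoS n + 1)) (hj : (j : ℕ) = h n + 1) :
    c.orderedProd Z (Function.update h n j) = c.orderedProd Z h * Z n (h n) := by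
  refine prod_ofFn_eq_mul n (fun i hi => ?_) ?_ fun i => ?_
  · rw [Function.update_of_ne hi]
  · rw [Function.update_self, hj, List.ofFn_succ', List.concat_eq_append, List.prod_append]
    simp
  · refine Commute.list_prod_right _ _ fun z hz => ?_
    obtain ⟨i, rfl⟩ := (List.mem_ofFn' _ _).1 hz
    exact hZ _ _ _ _

theorem orderedProd_commute {Z : Fin N → ℕ → c.Op} (hZ : ∀ n k m j, Commute (Z n k) (Z m j))
    (h : c.Conf) (n : Fin N) (k : ℕ) : Commute (c.orderedProd Z h) (Z n k) := by
  refine Commute.list_prod_left _ _ fun z hz => ?_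
  obtain ⟨i, rfl⟩ := (List.mem_ofFn' _ _).1 hz
  refine Commute.list_prod_left _ _ fun z hz => ?_
  obtain ⟨i, rfl⟩ := (List.mem_ofFn' _ _).1 hz
  exact hZ _ _ _ _

/-- The vectors `|h⟩`, without normalization. -/
def rightSeparate (h : c.Conf) : c.States := (c.rightSOVOp h).mulVec c.vac

/-- The covectors `⟨h|`, without normalization. -/
def leftSeparate (h : c.Conf) : c.States := Matrix.vecMul c.vac (c.leftSOVOp h)

/-- On vectors B raises and C lowers the labels. The D–B and C–D relations give the exchange rules,
and the quantum determinant gives `Y_X`. -/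
theorem rightSeparate_isSeparate (hη : c.Generic) (hc : c.CondInh) :
    c.IsSeparate (fun l => (c.opB l).mulVecLin) (fun l => (c.opC l).mulVecLin)
      (fun l => (c.opD l).mulVecLin) (fun n k => -(c.a (c.ξs n k))⁻¹) c.rightSeparate where
  D_X l m v hv := by
    have h := congrArg (fun M : c.Op => M.mulVec v) ((c.monodromy_RTT hη).D_B l m)
    simp only [Matrix.add_mulVec, Matrix.smul_mulVec, ← Matrix.mulVec_mulVec] at h
    simp only [Matrix.mulVecLin_apply] at hv ⊢
    simp only [opD, opB] at hv ⊢
    rw [← h, hv, Matrix.mulVec_zero, smul_zero, zero_add]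
  D_Y l m v hv := by
    -- The arguments are exchanged so that the unwanted term ends in D(m), which kills v; the signs
    -- are restored below.
    have h := congrArg (fun M : c.Op => M.mulVec v) ((c.monodromy_RTT hη).C_D m l)
    simp only [Matrix.add_mulVec, Matrix.smul_mulVec, ← Matrix.mulVec_mulVec] at h
    simp only [Matrix.mulVecLin_apply] at hv ⊢
    simp only [opD, opC] at hv ⊢
    rw [hv, Matrix.mulVec_zero, smul_zero, add_zero, ← neg_sub l m, neg_add_eq_sub,
      ← neg_sub (l - m) c.η, Complex.sinh_neg, Complex.sinh_neg, neg_smul, neg_smul,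
      neg_inj] at h
    exact h.symm
  Y_X l v hv := by
    have h := congrArg (fun M : c.Op => M.mulVec v) ((c.monodromy_HasQDet hη).A_D l)
    simp only [Matrix.sub_mulVec, Matrix.smul_mulVec, ← Matrix.mulVec_mulVec,
      Matrix.one_mulVec] at h
    simp only [Matrix.mulVecLin_apply] at hv ⊢
    simp only [opD, opC, opB] at hv ⊢
    rw [hv, Matrix.mulVec_zero, zero_sub] at h
    rw [neg_smul, ← h, neg_neg]
  cont v := (c.continuous_matrix c.opD_isTrig).matrix_mulVec continuous_const
  D_zero l := by
    have : c.rightSOVOp (fun _ => 0) = 1 :=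
      c.orderedProd_zero fun n k => -((c.a (c.ξs n k))⁻¹ • c.opB (c.ξs n k))
    simp only [rightSeparate, this, Matrix.one_mulVec, Matrix.mulVecLin_apply, opD_mulVec_vac]
  e_zero := by
    have : c.rightSOVOp (fun _ => 0) = 1 :=
      c.orderedProd_zero fun n k => -((c.a (c.ξs n k))⁻¹ • c.opB (c.ξs n k))
    rw [rightSeparate, this, Matrix.one_mulVec, vac]
    exact Pi.single_ne_zero_iff.2 one_ne_zero
  γ_ne n k hk := neg_ne_zero.2 (inv_ne_zero (c.a_ne_zero hη hc hk))
  e_succ h n j hj := by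
    have hZ : ∀ (n : Fin N) (k : ℕ) (m : Fin N) (j : ℕ),
        Commute (-((c.a (c.ξs n k))⁻¹ • c.opB (c.ξs n k)))
          (-((c.a (c.ξs m j))⁻¹ • c.opB (c.ξs m j))) := fun n k m j =>
      (((c.opB_commute hη _ _).smul_left _).smul_right _).neg_left.neg_right
    have h1 := c.orderedProd_update hZ h n j hj
    rw [(c.orderedProd_commute hZ h n (h n)).eq] at h1
    have h2 := congrArg (fun M : c.Op => M.mulVec c.vac) h1
    simp only [← Matrix.mulVec_mulVec] at h2
    refine h2.trans ?_
    rw [Matrix.neg_mulVec, Matrix.smul_mulVec, neg_smul]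
    rfl

theorem leftSeparate_isSeparate (hη : c.Generic) (hc : c.CondInh) :
    c.IsSeparate (fun l => (c.opC l).vecMulLinear) (fun l => (c.opB l).vecMulLinear)
      (fun l => (c.opD l).vecMulLinear) (fun n k => (c.d (c.ξs n (k + 1)))⁻¹)
      c.leftSeparate where
  D_X l m v hv := by
    have h := congrArg (fun M : c.Op => Matrix.vecMul v M) ((c.monodromy_RTT hη).D_C l m)
    simp only [Matrix.vecMul_add, Matrix.vecMul_smul, ← Matrix.vecMul_vecMul] at h
    simp only [Matrix.vecMulLinear_apply] at hv ⊢
    simp only [opD, opC] at hv ⊢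
    rw [h, hv, Matrix.zero_vecMul, smul_zero, zero_add]
  D_Y l m v hv := by
    have h := congrArg (fun M : c.Op => Matrix.vecMul v M) ((c.monodromy_RTT hη).B_D m l)
    simp only [Matrix.vecMul_add, Matrix.vecMul_smul, ← Matrix.vecMul_vecMul] at h
    simp only [Matrix.vecMulLinear_apply] at hv ⊢
    simp only [opD, opB] at hv ⊢
    rw [hv, Matrix.zero_vecMul, smul_zero, add_zero, ← neg_sub l m, neg_add_eq_sub,
      ← neg_sub (l - m) c.η, Complex.sinh_neg, Complex.sinh_neg, neg_smul, neg_smul,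
      neg_inj] at h
    exact h
  Y_X l v hv := by
    have h := congrArg (fun M : c.Op => Matrix.vecMul v M) ((c.monodromy_HasQDet hη).D_A l)
    simp only [Matrix.vecMul_sub, Matrix.vecMul_smul, ← Matrix.vecMul_vecMul,
      Matrix.vecMul_one] at h
    simp only [Matrix.vecMulLinear_apply] at hv ⊢
    simp only [opD, opC, opB] at hv ⊢
    rw [hv, Matrix.zero_vecMul, zero_sub] at h
    rw [neg_smul, ← h, neg_neg]
  cont v := continuous_const.matrix_vecMul (c.continuous_matrix c.opD_isTrig)
  D_zero l := by
    have : c.leftSOVOp (fun _ => 0) = 1 :=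
      c.orderedProd_zero fun n k => (c.d (c.ξs n (k + 1)))⁻¹ • c.opC (c.ξs n k)
    simp only [leftSeparate, this, Matrix.vecMul_one, Matrix.vecMulLinear_apply, vac_vecMul_opD]
  e_zero := by
    have : c.leftSOVOp (fun _ => 0) = 1 :=
      c.orderedProd_zero fun n k => (c.d (c.ξs n (k + 1)))⁻¹ • c.opC (c.ξs n k)
    rw [leftSeparate, this, Matrix.vecMul_one, vac]
    exact Pi.single_ne_zero_iff.2 one_ne_zero
  γ_ne n k hk := inv_ne_zero (c.d_ne_zero hη hc hk)
  e_succ h n j hj := by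
    have hZ : ∀ (n : Fin N) (k : ℕ) (m : Fin N) (j : ℕ),
        Commute ((c.d (c.ξs n (k + 1)))⁻¹ • c.opC (c.ξs n k))
          ((c.d (c.ξs m (j + 1)))⁻¹ • c.opC (c.ξs m j)) := fun n k m j =>
      ((c.opC_commute hη _ _).smul_left _).smul_right _
    have h2 := congrArg (fun M : c.Op => Matrix.vecMul c.vac M) (c.orderedProd_update hZ h n j hj)
    simp only [← Matrix.vecMul_vecMul] at h2
    refine h2.trans ?_
    rw [Matrix.vecMul_smul]
    rfl

/-- The off-diagonal part of `-Dmat`. -/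
def hop (n : Fin N) : Matrix (Fin (c.twoS n + 1)) (Fin (c.twoS n + 1)) ℂ :=
  fun i j => (if (j : ℕ) = i + 1 then -c.a (c.ξs n i) else 0) +
    (if (i : ℕ) = j + 1 then c.d (c.ξs n i) else 0)

theorem baxter_hop (t : ℂ → ℂ) (n : Fin N) : c.baxter c.hop t n = c.Dmat t n := by
  ext i j
  simp only [baxter, hop, Dmat, Matrix.sub_apply, Matrix.diagonal_apply, Fin.ext_iff]
  split_ifs <;> first | omega | simp_all

theorem baxter_hop_transpose (t : ℂ → ℂ) (n : Fin N) :
    c.baxter (fun n => (c.hop n).transpose) t n = (c.Dmat t n).transpose := by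
  rw [← baxter_hop, baxter, baxter, Matrix.transpose_sub, Matrix.diagonal_transpose]

theorem transfer_eq_sum_lagrange (κ : ℂ) {x : Fin N → ℂ}
    (hx : ∀ i j, i ≠ j → Complex.sinh (x i - x j) ≠ 0) (l : ℂ) :
    c.transfer κ l = ∑ n, lagrange x n l • c.transfer κ (x n) := by
  ext h g
  rw [Matrix.sum_apply]
  simpa only [Matrix.smul_apply, smul_eq_mul] using
    (c.transfer_isTrig κ h g).eq_interpolation hx l

/-- The normalization -1/a of the raising operators makes the raising coefficient -a, and by the
quantum determinant the lowering coefficient d: the off-diagonal part of -D^(n). -/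
theorem right_isSeparateTransfer (hη : c.Generic) (hc : c.CondInh) {κ : ℂ} (hκ : κ ≠ 0) :
    c.IsSeparateTransfer (fun l => (c.transfer κ l).mulVecLin) κ c.hop c.rightSeparate where
  linearIndependent := (c.rightSeparate_isSeparate hη hc).linearIndependent hη hc
  interpolation x hx l v := by
    simp only [Matrix.mulVecLin_apply]
    rw [c.transfer_eq_sum_lagrange κ hx, Matrix.sum_mulVec]
    simp only [Matrix.smul_mulVec]
  action h n := by
    have hX := (c.rightSeparate_isSeparate hη hc).X_e hη hc h n
    have hY := (c.rightSeparate_isSeparate hη hc).Y_e hη hc h n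
    simp only [Matrix.mulVecLin_apply] at hX hY ⊢
    rw [transfer, Matrix.add_mulVec, Matrix.smul_mulVec, Matrix.smul_mulVec, hX, hY,
      Finset.smul_sum, Finset.smul_sum, ← Finset.sum_add_distrib]
    refine Finset.sum_congr rfl fun j _ => ?_
    rw [smul_smul, smul_smul, ← add_smul]
    congr 1
    rw [hop, mul_add]
    congr 1
    · split_ifs with hj
      · rw [hj, inv_neg, inv_inv, pow_succ, ← mul_assoc (κ ^ _), ← mul_pow, mul_inv_cancel₀ hκ,
          one_pow, one_mul]
      · simp
    · split_ifs with hj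
      · have : c.a (c.ξs n j) ≠ 0 := c.a_ne_zero hη hc (by omega)
        rw [hj, pow_succ, mul_right_comm (κ ^ _), ← mul_pow, mul_inv_cancel₀ hκ, one_pow, one_mul]
        field_simp
      · simp

/-- On covectors C raises with twist κ, so the parameter is κ⁻¹, and the normalization 1/d yields
the transpose of the matrix found for vectors. -/
theorem left_isSeparateTransfer (hη : c.Generic) (hc : c.CondInh) {κ : ℂ} (hκ : κ ≠ 0) :
    c.IsSeparateTransfer (fun l => (c.transfer κ l).vecMulLinear) κ⁻¹
      (fun n => (c.hop n).transpose) c.leftSeparate where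
  linearIndependent := (c.leftSeparate_isSeparate hη hc).linearIndependent hη hc
  interpolation x hx l v := by
    simp only [Matrix.vecMulLinear_apply]
    rw [c.transfer_eq_sum_lagrange κ hx, Matrix.vecMul_sum]
    simp only [Matrix.vecMul_smul]
  action h n := by
    have hX := (c.leftSeparate_isSeparate hη hc).X_e hη hc h n
    have hY := (c.leftSeparate_isSeparate hη hc).Y_e hη hc h n
    simp only [Matrix.vecMulLinear_apply] at hX hY ⊢
    rw [transfer, Matrix.vecMul_add, Matrix.vecMul_smul, Matrix.vecMul_smul, hX, hY,
      Finset.smul_sum, Finset.smul_sum, ← Finset.sum_add_distrib]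
    refine Finset.sum_congr rfl fun j _ => ?_
    rw [smul_smul, smul_smul, ← add_smul]
    congr 1
    have hκ' : κ⁻¹ * κ⁻¹⁻¹ = 1 := mul_inv_cancel₀ (inv_ne_zero hκ)
    rw [Matrix.transpose_apply, hop, mul_add]
    congr 1
    · split_ifs with hj
      · have : c.d (c.ξs n (j + 1)) ≠ 0 := c.d_ne_zero hη hc (by omega)
        rw [hj, pow_succ, mul_right_comm (κ⁻¹ ^ _), ← mul_pow, hκ', one_pow, one_mul]
        field_simp
      · simp
    · split_ifs with hj
      · rw [hj, inv_inv, pow_succ, ← mul_assoc (κ⁻¹ ^ _), ← mul_pow, hκ', one_pow, one_mul,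
          inv_inv]
      · simp

/-! ### Eigenvectors as functionals on the separate states -/

namespace IsSeparateTransfer

variable {c} {T : ℂ → c.States →ₗ[ℂ] c.States} {r : ℂ}
  {A : (n : Fin N) → Matrix (Fin (c.twoS n + 1)) (Fin (c.twoS n + 1)) ℂ} {e : c.Conf → c.States}

theorem functional_eq_zero (hT : c.IsSeparateTransfer T r A e) {w : c.States →ₗ[ℂ] ℂ}
    (hw : ∀ h, w (e h) = 0) : w = 0 := by
  set b := basisOfLinearIndependentOfCardEqFinrank hT.linearIndependent
    (Module.finrank_fintype_fun_eq_card ℂ).symm with hb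
  refine b.ext fun h => ?_
  rw [hb, coe_basisOfLinearIndependentOfCardEqFinrank, hw, LinearMap.zero_apply]

/-- A nonzero w is nonzero on some basis state `e h`; varying hₙ alone then gives a null vector with
nonzero entry hₙ. -/
theorem det_baxter_eq_zero (hT : c.IsSeparateTransfer T r A e) (hr : r ≠ 0) {t : ℂ → ℂ}
    {w : c.States →ₗ[ℂ] ℂ} (hw0 : w ≠ 0) (hw : ∀ l v, w (T l v) = t l * w v) (n : Fin N) :
    (c.baxter A t n).det = 0 := by
  obtain ⟨h, hh⟩ : ∃ h, w (e h) ≠ 0 := by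
    by_contra! hcon
    exact hw0 (hT.functional_eq_zero hcon)
  refine Matrix.exists_mulVec_eq_zero_iff.1 ⟨_, fun h0 => hh ?_, hT.baxter_mulVec hr hw h n⟩
  have := congrFun h0 (h n)
  simp only [Function.update_eq_self, Pi.zero_apply] at this
  exact (mul_eq_zero.1 this).resolve_left (pow_ne_zero _ (inv_ne_zero hr))

/-- As a function of each single hₙ the values w(e h) form a null vector fixed by its entry 0, so
vanishing spreads from the reference state one coordinate at a time. This is the source of
simplicity. -/
theorem functional_eq_zero_of_apply_zero (hT : c.IsSeparateTransfer T r A e) (hr : r ≠ 0)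
    {t : ℂ → ℂ}
    (h0 : ∀ n, ∀ i j : Fin (c.twoS n + 1), (i : ℕ) + 1 < j → c.baxter A t n i j = 0)
    (h1 : ∀ n, ∀ i j : Fin (c.twoS n + 1), (j : ℕ) = i + 1 → c.baxter A t n i j ≠ 0)
    {w : c.States →ₗ[ℂ] ℂ} (hw : ∀ l v, w (T l v) = t l * w v) (hw0 : w (e fun _ => 0) = 0) :
    w = 0 := by
  have key : ∀ S : Finset (Fin N), ∀ h : c.Conf, (∀ n, n ∉ S → h n = 0) → w (e h) = 0 := by
    intro S
    induction S using Finset.induction_on with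
    | empty =>
      intro h hh
      rwa [show h = fun _ => 0 from funext fun n => hh n (Finset.notMem_empty n)]
    | insert n S _ ih =>
      intro h hh
      have h2 := eq_zero_of_hessenberg (h0 n) (h1 n) (hT.baxter_mulVec hr hw h n) (by
        rw [ih, mul_zero]
        intro m hm
        by_cases hmn : m = n
        · subst hmn
          simp
        · rw [Function.update_of_ne hmn]
          exact hh m (by simp [hmn, hm]))
      have := congrFun h2 (h n)
      simp only [Function.update_eq_self, Pi.zero_apply] at this
      exact (mul_eq_zero.1 this).resolve_left (pow_ne_zero _ (inv_ne_zero hr))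
  exact hT.functional_eq_zero fun h => key Finset.univ h fun n hn => absurd (Finset.mem_univ n) hn

end IsSeparateTransfer

/-- The linear form `u ↦ u ⬝ᵥ v`. -/
def pairing (v : c.States) : c.States →ₗ[ℂ] ℂ where
  toFun u := u ⬝ᵥ v
  map_add' u u' := add_dotProduct u u' v
  map_smul' a u := smul_dotProduct a u v

theorem pairing_apply (v u : c.States) : c.pairing v u = u ⬝ᵥ v := rfl

theorem pairing_ne_zero {v : c.States} (hv : v ≠ 0) : c.pairing v ≠ 0 := by
  intro h
  refine hv (funext fun i => ?_)
  have := LinearMap.congr_fun h (Pi.single i 1)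
  simpa [pairing_apply] using this

theorem pairing_vecMul {κ : ℂ} {t : ℂ → ℂ} {v : c.States}
    (hv : ∀ l, (c.transfer κ l).mulVec v = t l • v) (l : ℂ) (u : c.States) :
    c.pairing v ((c.transfer κ l).vecMulLinear u) = t l * c.pairing v u := by
  rw [pairing_apply, pairing_apply, Matrix.vecMulLinear_apply, ← Matrix.dotProduct_mulVec, hv,
    dotProduct_smul, smul_eq_mul]

theorem pairing_mulVec {κ : ℂ} {t : ℂ → ℂ} {v : c.States}
    (hv : ∀ l, Matrix.vecMul v (c.transfer κ l) = t l • v) (l : ℂ) (u : c.States) :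
    c.pairing v ((c.transfer κ l).mulVecLin u) = t l * c.pairing v u := by
  rw [pairing_apply, pairing_apply, Matrix.mulVecLin_apply, dotProduct_comm,
    Matrix.dotProduct_mulVec, hv, smul_dotProduct, smul_eq_mul, dotProduct_comm]

theorem Dmat_eq_zero (t : ℂ → ℂ) (n : Fin N) (i j : Fin (c.twoS n + 1)) (h : (i : ℕ) + 1 < j) :
    c.Dmat t n i j = 0 := by
  rw [Dmat, if_neg (by omega), if_neg (by omega), if_neg (by omega)]

theorem Dmat_transpose_eq_zero (t : ℂ → ℂ) (n : Fin N) (i j : Fin (c.twoS n + 1))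
    (h : (i : ℕ) + 1 < j) : (c.Dmat t n).transpose i j = 0 := by
  rw [Matrix.transpose_apply, Dmat, if_neg (by omega), if_neg (by omega), if_neg (by omega)]

theorem Dmat_ne_zero (hη : c.Generic) (hc : c.CondInh) (t : ℂ → ℂ) (n : Fin N)
    (i j : Fin (c.twoS n + 1)) (h : (j : ℕ) = i + 1) : c.Dmat t n i j ≠ 0 := by
  rw [Dmat, if_neg (by omega), if_pos h]
  exact c.a_ne_zero hη hc (by omega)

theorem Dmat_transpose_ne_zero (hη : c.Generic) (hc : c.CondInh) (t : ℂ → ℂ) (n : Fin N)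
    (i j : Fin (c.twoS n + 1)) (h : (j : ℕ) = i + 1) : (c.Dmat t n).transpose i j ≠ 0 := by
  rw [Matrix.transpose_apply, Dmat, if_neg (by omega), if_neg (by omega), if_pos h, h]
  exact neg_ne_zero.2 (c.d_ne_zero hη hc (by omega))

/-- At a nonzero coordinate of v the eigenvalue equation expresses t linearly through the matrix
elements of the transfer matrix. -/
theorem isTrig_of_eigenvector {κ : ℂ} {t : ℂ → ℂ} {v : c.States} (hv0 : v ≠ 0)
    (hv : ∀ l, (c.transfer κ l).mulVec v = t l • v) : IsTrig N t := by
  obtain ⟨h, hh⟩ := Function.ne_iff.1 hv0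
  have : t = fun l => (v h)⁻¹ * ∑ g, v g * c.transfer κ l h g := by
    funext l
    have := congrFun (hv l) h
    rw [Pi.smul_apply, smul_eq_mul, Matrix.mulVec, dotProduct] at this
    simp only [mul_comm (v _), this]
    field_simp [show v h ≠ 0 from hh]
  rw [this]
  exact (IsTrig.sum _ fun g _ => (c.transfer_isTrig κ h g).const_mul _).const_mul _

theorem mem_rightEigenspace {κ : ℂ} {t : ℂ → ℂ} {v : c.States} :
    v ∈ c.rightEigenspace κ t ↔ ∀ l, (c.transfer κ l).mulVec v = t l • v := by
  simp [rightEigenspace, Submodule.mem_iInf, sub_eq_zero]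

theorem mem_leftEigenspace {κ : ℂ} {t : ℂ → ℂ} {v : c.States} :
    v ∈ c.leftEigenspace κ t ↔ ∀ l, Matrix.vecMul v (c.transfer κ l) = t l • v := by
  simp [leftEigenspace, Submodule.mem_iInf, sub_eq_zero]

/-! ### Spectrum, eigenstates and simplicity -/

section Spectrum

variable {c} (hη : c.Generic) (hc : c.CondInh) {κ : ℂ} (hκ : κ ≠ 0)

include hη hc hκ

theorem det_Dmat_eq_zero {t : ℂ → ℂ} {v : c.States} (hv0 : v ≠ 0)
    (hv : ∀ l, (c.transfer κ l).mulVec v = t l • v) (n : Fin N) : (c.Dmat t n).det = 0 := by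
  have := (c.left_isSeparateTransfer hη hc hκ).det_baxter_eq_zero (inv_ne_zero hκ)
    (c.pairing_ne_zero hv0) (c.pairing_vecMul hv) n
  rwa [baxter_hop_transpose, Matrix.det_transpose] at this

theorem rightSeparateState_eigen {t : ℂ → ℂ} (ht : IsTrig N t)
    {p : (n : Fin N) → Fin (c.twoS n + 1) → ℂ}
    (hp : ∀ n, p n ≠ 0 ∧ Matrix.vecMul (p n) (c.Dmat t n) = 0) :
    c.separateState κ c.rightSeparate p ≠ 0 ∧
      ∀ l, (c.transfer κ l).mulVec (c.separateState κ c.rightSeparate p) =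
        t l • c.separateState κ c.rightSeparate p := by
  have hT := c.right_isSeparateTransfer hη hc hκ
  exact ⟨hT.separateState_ne_zero hc hκ fun n => (hp n).1,
    hT.apply_separateState hc hκ ht fun n => by rw [baxter_hop]; exact (hp n).2⟩

theorem leftSeparateState_eigen {t : ℂ → ℂ} (ht : IsTrig N t)
    {q : (n : Fin N) → Fin (c.twoS n + 1) → ℂ}
    (hq : ∀ n, q n ≠ 0 ∧ (c.Dmat t n).mulVec (q n) = 0) :
    c.separateState κ⁻¹ c.leftSeparate q ≠ 0 ∧
      ∀ l, Matrix.vecMul (c.separateState κ⁻¹ c.leftSeparate q) (c.transfer κ l) =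
        t l • c.separateState κ⁻¹ c.leftSeparate q := by
  have hT := c.left_isSeparateTransfer hη hc hκ
  exact ⟨hT.separateState_ne_zero hc (inv_ne_zero hκ) fun n => (hq n).1,
    hT.apply_separateState hc (inv_ne_zero hκ) ht fun n => by
      rw [baxter_hop_transpose, Matrix.vecMul_transpose]; exact (hq n).2⟩

/-- Phrased with `IsTrig` instead of interpolation at the points ξₙ, so that simplicity does not
require these points to be distinct modulo iπ. -/
theorem mem_eigenvalueFunctions_iff {t : ℂ → ℂ} :
    t ∈ c.eigenvalueFunctions κ ↔ IsTrig N t ∧ ∀ n, (c.Dmat t n).det = 0 := by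
  constructor
  · rintro ⟨v, hv0, hv⟩
    exact ⟨c.isTrig_of_eigenvector hv0 hv, det_Dmat_eq_zero hη hc hκ hv0 hv⟩
  · rintro ⟨ht, hdet⟩
    choose p hp using fun n => Matrix.exists_vecMul_eq_zero_iff.2 (hdet n)
    exact ⟨_, rightSeparateState_eigen hη hc hκ ht hp⟩

/-- Eigenvectors are functionals on the left separate states, and pairing with the left reference
state is injective on the eigenspace. -/
theorem finrank_rightEigenspace {t : ℂ → ℂ} (ht : t ∈ c.eigenvalueFunctions κ) :
    Module.finrank ℂ (c.rightEigenspace κ t) = 1 := by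
  apply le_antisymm
  · have hT := c.left_isSeparateTransfer hη hc hκ
    have hinj : Function.Injective ((c.pairing (c.leftSeparate fun _ => 0)).comp
        (c.rightEigenspace κ t).subtype) := by
      rw [← LinearMap.ker_eq_bot, LinearMap.ker_eq_bot']
      intro v hv
      by_contra hv0
      refine c.pairing_ne_zero (v := v) (fun h => hv0 (Subtype.ext h)) ?_
      refine hT.functional_eq_zero_of_apply_zero (t := t) (inv_ne_zero hκ) (fun n => ?_)
        (fun n => ?_) (c.pairing_vecMul (c.mem_rightEigenspace.1 v.2)) ?_
      · rw [baxter_hop_transpose]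
        exact c.Dmat_transpose_eq_zero t n
      · rw [baxter_hop_transpose]
        exact c.Dmat_transpose_ne_zero hη hc t n
      · rw [pairing_apply, dotProduct_comm]
        exact hv
    simpa using LinearMap.finrank_le_finrank_of_injective hinj
  · obtain ⟨v, hv0, hv⟩ := ht
    rw [Nat.one_le_iff_ne_zero, ← Nat.pos_iff_ne_zero, Module.finrank_pos_iff]
    exact ⟨⟨v, c.mem_rightEigenspace.2 hv⟩, 0, fun h => hv0 (congrArg Subtype.val h)⟩

theorem finrank_leftEigenspace {t : ℂ → ℂ} (ht : t ∈ c.eigenvalueFunctions κ) :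
    Module.finrank ℂ (c.leftEigenspace κ t) = 1 := by
  apply le_antisymm
  · have hT := c.right_isSeparateTransfer hη hc hκ
    have hinj : Function.Injective ((c.pairing (c.rightSeparate fun _ => 0)).comp
        (c.leftEigenspace κ t).subtype) := by
      rw [← LinearMap.ker_eq_bot, LinearMap.ker_eq_bot']
      intro v hv
      by_contra hv0
      refine c.pairing_ne_zero (v := v) (fun h => hv0 (Subtype.ext h)) ?_
      refine hT.functional_eq_zero_of_apply_zero (t := t) hκ (fun n => ?_)
        (fun n => ?_) (c.pairing_mulVec (c.mem_leftEigenspace.1 v.2)) ?_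
      · rw [baxter_hop]
        exact c.Dmat_eq_zero t n
      · rw [baxter_hop]
        exact c.Dmat_ne_zero hη hc t n
      · rw [pairing_apply, dotProduct_comm]
        exact hv
    simpa using LinearMap.finrank_le_finrank_of_injective hinj
  -- Eigenvalue functions are defined by right eigenvectors; a left one is constructed from null
  -- vectors of the D^(n).
  · obtain ⟨ht', hdet⟩ := (mem_eigenvalueFunctions_iff hη hc hκ).1 ht
    choose q hq using fun n => Matrix.exists_mulVec_eq_zero_iff.2 (hdet n)
    obtain ⟨hv0, hv⟩ := leftSeparateState_eigen hη hc hκ ht' hq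
    rw [Nat.one_le_iff_ne_zero, ← Nat.pos_iff_ne_zero, Module.finrank_pos_iff]
    exact ⟨⟨_, c.mem_leftEigenspace.2 hv⟩, 0, fun h => hv0 (congrArg Subtype.val h)⟩

theorem finrank_ker_Dmat {t : ℂ → ℂ} (ht : t ∈ c.eigenvalueFunctions κ) (n : Fin N) :
    Module.finrank ℂ (LinearMap.ker (c.Dmat t n).mulVecLin) = 1 ∧
      Module.finrank ℂ (LinearMap.ker (c.Dmat t n).vecMulLinear) = 1 := by
  have hdet := ((mem_eigenvalueFunctions_iff hη hc hκ).1 ht).2 n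
  refine ⟨finrank_ker_of_hessenberg (c.Dmat_eq_zero t n) (c.Dmat_ne_zero hη hc t n) hdet, ?_⟩
  rw [← Matrix.mulVecLin_transpose]
  exact finrank_ker_of_hessenberg (c.Dmat_transpose_eq_zero t n)
    (c.Dmat_transpose_ne_zero hη hc t n) (by rwa [Matrix.det_transpose])

end Spectrum

/-! ### Interpolation at the points ξₙ and normalization of the eigenstates -/

theorem isInterpolation_iff (hd : c.DistinctNodes) {t : ℂ → ℂ} :
    c.IsInterpolation t ↔ IsTrig N t := by
  constructor
  · intro h
    have : t = fun l => ∑ n, t (c.ξ n) * lagrange c.ξ n l := by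
      funext l
      rw [h l]
      exact Finset.sum_congr rfl fun n _ => mul_comm _ _
    rw [this]
    exact IsTrig.sum _ fun n _ => (lagrange_isTrig c.ξ n).const_mul _
  · exact fun h l => h.eq_interpolation hd l

/-- The normalization of the reference states. -/
def normalization : ℂ :=
  ∏ j : Fin N, ∏ i ∈ Finset.Iio j, Complex.sinh (c.ξ j - c.ξ i) ^ (1 / 2 : ℂ)

theorem normalization_ne_zero (hd : c.DistinctNodes) : c.normalization ≠ 0 :=
  Finset.prod_ne_zero_iff.2 fun j _ => Finset.prod_ne_zero_iff.2 fun i hi h =>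
    hd j i (Finset.mem_Iio.1 hi).ne' ((Complex.cpow_eq_zero_iff _ _).1 h).1

theorem refState_eq : c.refState = c.normalization⁻¹ • c.vac := rfl

theorem rightEigenstate_eq (κ : ℂ) (p : (n : Fin N) → Fin (c.twoS n + 1) → ℂ) :
    c.rightEigenstate κ p = c.normalization⁻¹ • c.separateState κ c.rightSeparate p := by
  rw [rightEigenstate, separateState, Finset.smul_sum]
  refine Finset.sum_congr rfl fun h _ => ?_
  rw [ket, refState_eq, Matrix.mulVec_smul, smul_comm]
  rfl

theorem leftEigenstate_eq (κ : ℂ) (q : (n : Fin N) → Fin (c.twoS n + 1) → ℂ) :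
    c.leftEigenstate κ q = c.normalization⁻¹ • c.separateState κ⁻¹ c.leftSeparate q := by
  rw [leftEigenstate, separateState, Finset.smul_sum]
  refine Finset.sum_congr rfl fun h _ => ?_
  rw [bra, refState_eq, Matrix.smul_vecMul, smul_comm, inv_inv]
  rfl

end SpinChain

end

theorem theorem3p2 {N : ℕ} (c : SpinChain N) (hη : c.Generic) :
    -- for each twist the transfer matrices commute
    (∀ κ : ℂ, κ ≠ 0 → ∀ l m : ℂ, Commute (c.transfer κ l) (c.transfer κ m)) ∧
    -- all these families have the same set of eigenvalue functions
    (∀ κ κ' : ℂ, κ ≠ 0 → κ' ≠ 0 → c.eigenvalueFunctions κ = c.eigenvalueFunctions κ') ∧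
    (c.CondInh → ∀ κ : ℂ, κ ≠ 0 →
      -- simplicity of the spectrum
      (∀ t ∈ c.eigenvalueFunctions κ,
        Module.finrank ℂ (c.rightEigenspace κ t) = 1 ∧
        Module.finrank ℂ (c.leftEigenspace κ t) = 1) ∧
      -- the right and left nullspaces of the tridiagonal matrices are lines
      (∀ t ∈ c.eigenvalueFunctions κ, ∀ n : Fin N,
        Module.finrank ℂ (LinearMap.ker (c.Dmat t n).mulVecLin) = 1 ∧
        Module.finrank ℂ (LinearMap.ker (c.Dmat t n).vecMulLinear) = 1) ∧
      (c.DistinctNodes →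
        -- characterization of the spectrum
        c.eigenvalueFunctions κ =
          {t | c.IsInterpolation t ∧ ∀ n : Fin N, (c.Dmat t n).det = 0} ∧
        -- the left and the right eigenstates
        (∀ t ∈ c.eigenvalueFunctions κ,
          (∀ q : (n : Fin N) → Fin (c.twoS n + 1) → ℂ,
            (∀ n, q n ≠ 0 ∧ (c.Dmat t n).mulVec (q n) = 0) →
            c.leftEigenstate κ q ≠ 0 ∧
            ∀ l : ℂ, Matrix.vecMul (c.leftEigenstate κ q) (c.transfer κ l) =
              t l • c.leftEigenstate κ q) ∧
          (∀ p : (n : Fin N) → Fin (c.twoS n + 1) → ℂ,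
            (∀ n, p n ≠ 0 ∧ Matrix.vecMul (p n) (c.Dmat t n) = 0) →
            c.rightEigenstate κ p ≠ 0 ∧
            ∀ l : ℂ, (c.transfer κ l).mulVec (c.rightEigenstate κ p) =
              t l • c.rightEigenstate κ p)))) := by
  refine ⟨fun κ hκ l m => c.transfer_commute hη hκ l m, fun κ κ' hκ hκ' =>
    (c.eigenvalueFunctions_subset hκ hκ').antisymm (c.eigenvalueFunctions_subset hκ' hκ),
    fun hc κ hκ => ⟨fun t ht => ⟨SpinChain.finrank_rightEigenspace hη hc hκ ht,
      SpinChain.finrank_leftEigenspace hη hc hκ ht⟩,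
      fun t ht n => SpinChain.finrank_ker_Dmat hη hc hκ ht n, fun hd => ⟨?_, fun t ht => ?_⟩⟩⟩
  · ext t
    rw [SpinChain.mem_eigenvalueFunctions_iff hη hc hκ, ← c.isInterpolation_iff hd]
    rfl
  · have ht' := ((SpinChain.mem_eigenvalueFunctions_iff hη hc hκ).1 ht).1
    have hn := inv_ne_zero (c.normalization_ne_zero hd)
    constructor
    · intro q hq
      obtain ⟨h0, h1⟩ := SpinChain.leftSeparateState_eigen hη hc hκ ht' hq
      rw [c.leftEigenstate_eq]
      exact ⟨smul_ne_zero hn h0, fun l => by rw [Matrix.smul_vecMul, h1, smul_comm]⟩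
    · intro p hp
      obtain ⟨h0, h1⟩ := SpinChain.rightSeparateState_eigen hη hc hκ ht' hp
      rw [c.rightEigenstate_eq]
      exact ⟨smul_ne_zero hn h0, fun l => by rw [Matrix.mulVec_smul, h1, smul_comm]⟩
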